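/- Let $d\ge 1$, let $|\cdot|$ be a norm on $\mathbb{R}^d$, and let $1\le p<q<\infty$. For Borel probability measures $\mu,\nu$ on $\mathbb{R}^d$ put $$\mathcal W_p(\mu,\nu)=\inf\big\{(\mathbb E|X-Y|^p)^{1/p}: X\sim\mu,\ Y\sim\nu\big\},\qquad M_{\frac{\mu+\nu}2}(q)=\tfrac12\int_{\mathbb{R}^d}|\xi|^q\,(\mu+\nu)(d\xi),$$ $$D^\infty(\mu,\nu)=\sup_{x,y\in\mathbb{R}^d}\Big|\mu\Big(\prod_{i=1}^d[x^i,y^i]\Big)-\nu\Big(\prod_{i=1}^d[x^i,y^i]\Big)\Big|,\qquad D^\star(\mu,\nu)=\sup_{x\in\mathbb{R}^d}\Big|\mu\Big(\prod_{i=1}^d(-\infty,x^i]\Big)-\nu\Big(\prod_{i=1}^d(-\infty,x^i]\Big)\Big|,$$ where $\prod_i[x^i,y^i]=\emptyset$ unless $x^i\le y^i$ for all $i$. Then there is a constant $\kappa=\kappa_{p,q,d}>0$, depending only on $p$, $q$, $d$ and the norm, such that for all Borel probability measures $\mu,\nu$ on $\mathbb{R}^d$ with finite $q$-moments: (i) if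 $p<\frac{dq}{q+d}$, then $$\mathcal W_p^p(\mu,\nu)\le\kappa\,\big(M_{\frac{\mu+\nu}2}(q)\vee1\big)\,D^\infty(\mu,\nu)^{p/d};$$ (ii) if $p>\frac{dq}{q+d}$ and $p\ne d$, then $$\mathcal W_p^p(\mu,\nu)\le\kappa\,\big(M_{\frac{\mu+\nu}2}(q)\vee1\big)\,D^\infty(\mu,\nu)^{1-p/q}.$$ Moreover, with the same constant $\kappa$, both bounds remain valid when $D^\infty(\mu,\nu)$ is replaced by $2^d D^\star(\mu,\nu)$. -/

import Mathlib

open MeasureTheory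
open scoped ENNReal

noncomputable section

/-- Couplings of `μ` and `ν`: the joint laws of pairs `(X, Y)` with `X ∼ μ` and `Y ∼ ν`. -/
def couplings {d : ℕ} (μ ν : Measure (Fin d → ℝ)) : Set (Measure ((Fin d → ℝ) × (Fin d → ℝ))) :=
  {π | π.fst = μ ∧ π.snd = ν}

/-- The `p`-Wasserstein distance on `ℝ^d` for the norm `N`:
the infimum of `(𝔼 [N (X - Y) ^ p]) ^ (1 / p)` over the couplings of `μ` and `ν`. -/
def wasserstein {d : ℕ} (N : Seminorm ℝ (Fin d → ℝ)) (p : ℝ) (μ ν : Measure (Fin d → ℝ)) : ℝ≥0∞ :=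
  ⨅ π ∈ couplings μ ν, (∫⁻ z, ENNReal.ofReal (N (z.1 - z.2)) ^ p ∂π) ^ (1 / p)

/-- The moment of order `q` for the norm `N`: the integral of `N ξ ^ q` against `m`. -/
def absMoment {d : ℕ} (N : Seminorm ℝ (Fin d → ℝ)) (q : ℝ) (m : Measure (Fin d → ℝ)) : ℝ≥0∞ :=
  ∫⁻ ξ, ENNReal.ofReal (N ξ) ^ q ∂m

/-- The uniform discrepancy: the supremum of `|μ B - ν B|` over closed boxes `B = ∏ [x i, y i]`
(the order on `Fin d → ℝ` is coordinatewise; the box is empty unless `x ≤ y`). -/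
def uniformDiscrepancy {d : ℕ} (μ ν : Measure (Fin d → ℝ)) : ℝ≥0∞ :=
  ⨆ (x : Fin d → ℝ) (y : Fin d → ℝ),
    ENNReal.ofReal |μ.real (Set.Icc x y) - ν.real (Set.Icc x y)|

/-- The Kolmogorov-Smirnov distance: the supremum of `|μ Q - ν Q|` over the lower orthants
`Q = ∏ (-∞, x i]`. -/
def ksDistance {d : ℕ} (μ ν : Measure (Fin d → ℝ)) : ℝ≥0∞ :=
  ⨆ x : Fin d → ℝ, ENNReal.ofReal |μ.real (Set.Iic x) - ν.real (Set.Iic x)|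

end

/-!
The proof is a multiscale matching. The space is cut into the cube `[-1, 1) ^ d` (shell `0`) and the
dyadic shells `[-2 ^ n, 2 ^ n) ^ d \ [-2 ^ (n - 1), 2 ^ (n - 1)) ^ d` for `n ≥ 1`, and at level `l`
each shell is cut into cells of side `2 ^ (n - l)`; these partitions refine each other as `l` grows.
Matching mass greedily from the finest level upwards gives one coupling of `μ` and `ν` that, at every level, keeps the mass
`min (μ F) (ν F)` inside each cell `F` (`exists_coupling_of_refining`). A pair that is first
separated at level `l` is at distance at most of order `2 ^ (n - l)`, so up to constants
`W_p ^ p ≤ ∑ l n, 2 ^ (p (n - l)) ∑ F, (μ F - ν F)⁺ + (ν F - μ F)⁺`, the inner sum being over the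
cells of level `l` in shell `n` (`wasserstein_rpow_le_tsum`).

There are at most `2 ^ d * 2 ^ (d l)` such cells, and each is a box or a difference of two boxes, so
the inner sum is at most a multiple of `2 ^ (d l) D`, where `D` is the uniform discrepancy; it is
also at most the mass of the shell, which Markov's inequality bounds by a multiple of
`M 2 ^ (-q n)`, where `M` is the larger of `1` and the `q`-th moment of `(μ + ν) / 2`
(`tsum_measure_dyadicCell_sub_le`, `measure_shell_le`). What remains is the double
series `∑ l n, 2 ^ (p (n - l)) min (2 ^ (d l) D) (M 2 ^ (-q n))`. A sum of minima of an increasing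
and a decreasing geometric sequence is comparable to their value at the crossing point
(`exists_tsum_min_le`). If `p < d q / (q + d)`, this is applied to the sum over `l`, and the sum
over `n` then converges and gives the exponent `p / d`; if `p > d q / (q + d)`, the roles of `l` and `n`
are exchanged and the exponent is `1 - p / q`.

The bounds in terms of the Kolmogorov-Smirnov distance follow, since a box is obtained from lower
orthants by `d` successive differences (`uniformDiscrepancy_le_two_pow_mul_ksDistance`).
-/

open Filter Topology

/-! ### Couplings adapted to refining partitions -/

/-- For a countable partition of `X` (the fibres of `f`) there is a partial coupling that matches, in
each cell, as much mass as possible, and matches nothing across cells. On the cell `F` it is the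
product of the restrictions of `μ` and `ν`, rescaled to total mass `min (μ F) (ν F)`. -/
theorem exists_cellwise_coupling {X ι : Type*} [MeasurableSpace X] [MeasurableSpace ι]
    [MeasurableSingletonClass ι] [Countable ι] (μ ν : Measure X) [IsFiniteMeasure μ]
    [IsFiniteMeasure ν] {f : X → ι} (hf : Measurable f) :
    ∃ π : Measure (X × X), π.fst ≤ μ ∧ π.snd ≤ ν ∧ π {z | f z.1 ≠ f z.2} = 0 ∧
      ∀ i, π {z | f z.1 = i ∧ f z.2 = i} = min (μ (f ⁻¹' {i})) (ν (f ⁻¹' {i})) := by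
  have hF : ∀ i, MeasurableSet (f ⁻¹' {i}) := fun i => hf (measurableSet_singleton i)
  have hdisj : Pairwise (Function.onFun Disjoint fun i => f ⁻¹' {i}) := fun i j hij =>
    Disjoint.preimage f (by simpa using hij)
  have hcover : ⋃ i, f ⁻¹' {i} = Set.univ := by ext x; simp
  have hle : ∀ r s : ℝ≥0∞, s ≠ ∞ → min r s / (r * s) * s ≤ 1 := by
    intro r s hs
    rcases eq_or_ne s 0 with rfl | hs0
    · simp
    · rw [ENNReal.div_eq_inv_mul, ENNReal.mul_inv (Or.inr hs) (Or.inr hs0)]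
      calc r⁻¹ * s⁻¹ * min r s * s = r⁻¹ * min r s * (s⁻¹ * s) := by ring
        _ = r⁻¹ * min r s := by rw [ENNReal.inv_mul_cancel hs0 hs, mul_one]
        _ ≤ r⁻¹ * r := by gcongr; exact min_le_left _ _
        _ ≤ 1 := ENNReal.inv_mul_le_one r
  let c : ι → ℝ≥0∞ := fun i =>
    min (μ (f ⁻¹' {i})) (ν (f ⁻¹' {i})) / (μ (f ⁻¹' {i}) * ν (f ⁻¹' {i}))
  have hc1 : ∀ i, c i * ν (f ⁻¹' {i}) ≤ 1 := fun i => hle _ _ (measure_ne_top _ _)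
  have hc2 : ∀ i, c i * μ (f ⁻¹' {i}) ≤ 1 := fun i => by
    have := hle (ν (f ⁻¹' {i})) (μ (f ⁻¹' {i})) (measure_ne_top _ _)
    rwa [min_comm, mul_comm (ν _)] at this
  let π : Measure (X × X) := Measure.sum fun i =>
    c i • (μ.restrict (f ⁻¹' {i})).prod (ν.restrict (f ⁻¹' {i}))
  refine ⟨π, ?_, ?_, ?_, ?_⟩
  · refine Measure.le_iff.2 fun A hA => ?_
    have hA' : MeasurableSet (Prod.fst ⁻¹' A : Set (X × X)) := measurable_fst hA
    rw [Measure.fst_apply hA, Measure.sum_apply _ hA']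
    calc _ ≤ ∑' i, μ.restrict (f ⁻¹' {i}) A := by
          refine ENNReal.tsum_le_tsum fun i => ?_
          rw [← Set.prod_univ, Measure.smul_apply, Measure.prod_prod, smul_eq_mul,
            Measure.restrict_apply_univ, mul_comm (μ.restrict _ A), ← mul_assoc]
          exact mul_le_of_le_one_left' (hc1 i)
      _ = μ A := by
          rw [← Measure.sum_apply _ hA, ← Measure.restrict_iUnion hdisj hF, hcover,
            Measure.restrict_univ]
  · refine Measure.le_iff.2 fun A hA => ?_
    have hA' : MeasurableSet (Prod.snd ⁻¹' A : Set (X × X)) := measurable_snd hA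
    rw [Measure.snd_apply hA, Measure.sum_apply _ hA']
    calc _ ≤ ∑' i, ν.restrict (f ⁻¹' {i}) A := by
          refine ENNReal.tsum_le_tsum fun i => ?_
          rw [← Set.univ_prod, Measure.smul_apply, Measure.prod_prod, smul_eq_mul,
            Measure.restrict_apply_univ, ← mul_assoc]
          exact mul_le_of_le_one_left' (hc2 i)
      _ = ν A := by
          rw [← Measure.sum_apply _ hA, ← Measure.restrict_iUnion hdisj hF, hcover,
            Measure.restrict_univ]
  · rw [Measure.sum_apply_eq_zero]
    intro i
    rw [Measure.smul_apply, Measure.prod_restrict]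
    have : ((μ.prod ν).restrict ((f ⁻¹' {i}) ×ˢ (f ⁻¹' {i}))) {z | f z.1 ≠ f z.2} = 0 := by
      have hm := ((hF i).prod (hF i))
      have := ae_restrict_mem (μ := μ.prod ν) hm
      refine measure_mono_null ?_ (mem_ae_iff.1 this)
      rintro z hz ⟨h1, h2⟩
      exact hz (by simp_all)
    simp [this]
  · intro i
    have hset : {z : X × X | f z.1 = i ∧ f z.2 = i} = (f ⁻¹' {i}) ×ˢ (f ⁻¹' {i}) := by
      ext z; simp
    rw [hset, Measure.sum_apply _ ((hF i).prod (hF i)), tsum_eq_single i]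
    · rw [Measure.smul_apply, Measure.prod_prod, Measure.restrict_apply_self,
        Measure.restrict_apply_self, smul_eq_mul]
      by_cases h0 : μ (f ⁻¹' {i}) * ν (f ⁻¹' {i}) = 0
      · rcases mul_eq_zero.1 h0 with h | h <;> simp [h]
      · exact ENNReal.div_mul_cancel h0 (ENNReal.mul_ne_top (measure_ne_top _ _)
          (measure_ne_top _ _))
    · intro j hj
      rw [Measure.smul_apply, Measure.prod_prod, Measure.restrict_apply (hF i),
        (hdisj hj.symm).inter_eq]
      simp

/-- Greedy matching along partitions that become coarser with `k`: at each step the mass left over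
by the finer partitions is matched as far as possible inside the cells of the next one. All the mass
matched so far lies in common cells, so the matched mass in a cell is the same for both marginals;
hence the greedy step brings it up to the minimum of the two masses of the cell. -/
theorem exists_partial_coupling {X ι : Type*} [MeasurableSpace X] [MeasurableSpace ι]
    [MeasurableSingletonClass ι] [Countable ι] (μ ν : Measure X) [IsFiniteMeasure μ]
    [IsFiniteMeasure ν] {f : ℕ → X → ι} (hf : ∀ k, Measurable (f k))
    (hcoarse : ∀ k x y, f k x = f k y → f (k + 1) x = f (k + 1) y) (K : ℕ) :
    ∃ π : Measure (X × X), π.fst ≤ μ ∧ π.snd ≤ ν ∧ π {z | f K z.1 ≠ f K z.2} = 0 ∧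
      ∀ k ≤ K, ∀ i, min (μ (f k ⁻¹' {i})) (ν (f k ⁻¹' {i})) ≤
        π {z | f k z.1 = i ∧ f k z.2 = i} := by
  induction K with
  | zero =>
    obtain ⟨π, h1, h2, h3, h4⟩ := exists_cellwise_coupling μ ν (hf 0)
    refine ⟨π, h1, h2, h3, fun k hk i => ?_⟩
    obtain rfl : k = 0 := by omega
    exact (h4 i).ge
  | succ K ih =>
    obtain ⟨π, h1, h2, h3, h4⟩ := ih
    have hfin1 : IsFiniteMeasure π.fst := isFiniteMeasure_of_le μ h1
    have hfin2 : IsFiniteMeasure π.snd := isFiniteMeasure_of_le ν h2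
    obtain ⟨ρ, g1, g2, g3, g4⟩ :=
      exists_cellwise_coupling (μ - π.fst) (ν - π.snd) (hf (K + 1))
    -- the mass matched at finer levels stays within the cells of the coarser partition
    have hπ : ∀ᵐ z ∂π, f (K + 1) z.1 = f (K + 1) z.2 := by
      refine measure_mono_null ?_ h3
      intro z hz h
      exact hz (hcoarse K _ _ h)
    refine ⟨π + ρ, ?_, ?_, ?_, ?_⟩
    · calc (π + ρ).fst = π.fst + ρ.fst := Measure.map_add _ _ measurable_fst
        _ ≤ π.fst + (μ - π.fst) := by gcongr
        _ = μ := by rw [add_comm]; exact Measure.sub_add_cancel_of_le h1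
    · calc (π + ρ).snd = π.snd + ρ.snd := Measure.map_add _ _ measurable_snd
        _ ≤ π.snd + (ν - π.snd) := by gcongr
        _ = ν := by rw [add_comm]; exact Measure.sub_add_cancel_of_le h2
    · rw [Measure.add_apply, g3, add_zero]
      exact mem_ae_iff.1 hπ
    · intro k hk i
      rcases Nat.lt_or_ge k (K + 1) with hlt | hge
      · refine (h4 k (by omega) i).trans ?_
        rw [Measure.add_apply]
        exact le_self_add
      · obtain rfl : k = K + 1 := by omega
        have hF : MeasurableSet (f (K + 1) ⁻¹' {i}) := hf _ (measurableSet_singleton i)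
        have e1 : π.fst (f (K + 1) ⁻¹' {i}) =
            π {z | f (K + 1) z.1 = i ∧ f (K + 1) z.2 = i} := by
          rw [Measure.fst_apply hF]
          refine measure_congr ?_
          filter_upwards [hπ] with z hz
          simp only [eq_iff_iff]
          change f (K + 1) z.1 = i ↔ (f (K + 1) z.1 = i ∧ f (K + 1) z.2 = i)
          rw [← hz, and_self]
        have e2 : π.snd (f (K + 1) ⁻¹' {i}) =
            π {z | f (K + 1) z.1 = i ∧ f (K + 1) z.2 = i} := by
          rw [Measure.snd_apply hF]
          refine measure_congr ?_
          filter_upwards [hπ] with z hz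
          simp only [eq_iff_iff]
          change f (K + 1) z.2 = i ↔ (f (K + 1) z.1 = i ∧ f (K + 1) z.2 = i)
          rw [← hz, and_self]
        rw [Measure.add_apply, g4, Measure.sub_apply hF h1, Measure.sub_apply hF h2, e1, e2,
          ← min_add_add_left, add_tsub_cancel_of_le, add_tsub_cancel_of_le]
        · exact e2 ▸ h2 _
        · exact e1 ▸ h1 _

/-- Along partitions that become finer with `l`, a single coupling matches the maximal possible mass
in each cell of each level `l ≤ L`. -/
theorem exists_coupling_of_refining {X ι : Type*} [MeasurableSpace X] [MeasurableSpace ι]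
    [MeasurableSingletonClass ι] [Countable ι] (μ ν : Measure X) [IsProbabilityMeasure μ]
    [IsProbabilityMeasure ν] {f : ℕ → X → ι} (hf : ∀ l, Measurable (f l))
    (hrefine : ∀ l x y, f (l + 1) x = f (l + 1) y → f l x = f l y) (L : ℕ) :
    ∃ π : Measure (X × X), π.fst = μ ∧ π.snd = ν ∧
      ∀ l ≤ L, ∀ i, min (μ (f l ⁻¹' {i})) (ν (f l ⁻¹' {i})) ≤
        π {z | f l z.1 = i ∧ f l z.2 = i} := by
  obtain ⟨π, h1, h2, -, h4⟩ := exists_partial_coupling μ ν (f := fun k => f (L - k))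
    (fun k => hf _) (fun k x y h => by
      rcases Nat.lt_or_ge k L with hk | hk
      · apply hrefine
        rwa [show L - (k + 1) + 1 = L - k by omega]
      · rwa [show L - (k + 1) = L - k by omega]) L
  have hfin1 : IsFiniteMeasure π.fst := isFiniteMeasure_of_le μ h1
  have hfin2 : IsFiniteMeasure π.snd := isFiniteMeasure_of_le ν h2
  -- the unmatched mass is coupled arbitrarily, through the partition with a single cell
  obtain ⟨ρ, g1, g2, -, g4⟩ :=
    exists_cellwise_coupling (μ - π.fst) (ν - π.snd) (f := fun _ => ()) measurable_const
  have hmass : ρ Set.univ = 1 - π Set.univ := by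
    have := g4 ()
    simpa [Measure.sub_apply MeasurableSet.univ h1, Measure.sub_apply MeasurableSet.univ h2,
      Measure.fst_univ, Measure.snd_univ] using this
  have hπ1 : π Set.univ ≤ 1 := by
    have := h1 Set.univ
    rwa [Measure.fst_univ, measure_univ (μ := μ)] at this
  have htot : (π + ρ) Set.univ = 1 := by
    rw [Measure.add_apply, hmass, add_tsub_cancel_of_le hπ1]
  have hfin : IsProbabilityMeasure (π + ρ) := ⟨htot⟩
  refine ⟨π + ρ, ?_, ?_, ?_⟩
  · refine Measure.eq_of_le_of_measure_univ_eq ?_ (by simp only [measure_univ])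
    calc (π + ρ).fst = π.fst + ρ.fst := Measure.map_add _ _ measurable_fst
      _ ≤ π.fst + (μ - π.fst) := by gcongr
      _ = μ := by rw [add_comm]; exact Measure.sub_add_cancel_of_le h1
  · refine Measure.eq_of_le_of_measure_univ_eq ?_ (by simp only [measure_univ])
    calc (π + ρ).snd = π.snd + ρ.snd := Measure.map_add _ _ measurable_snd
      _ ≤ π.snd + (ν - π.snd) := by gcongr
      _ = ν := by rw [add_comm]; exact Measure.sub_add_cancel_of_le h2
  · intro l hl i
    have := h4 (L - l) (by omega) i
    simp only [show L - (L - l) = l by omega] at this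
    refine this.trans ?_
    rw [Measure.add_apply]
    exact le_self_add

/-- A coupling that matches the maximal mass in each cell separates, in each cell, at most the excess
of `μ` over `ν`. -/
theorem lintegral_ite_ne_le {X ι : Type*} [MeasurableSpace X] [MeasurableSpace ι]
    [MeasurableSingletonClass ι] [Countable ι] [DecidableEq ι] {μ ν : Measure X}
    {π : Measure (X × X)} [IsFiniteMeasure π]
    (hπ : π.fst = μ) {f : X → ι} (hf : Measurable f)
    (h : ∀ i, min (μ (f ⁻¹' {i})) (ν (f ⁻¹' {i})) ≤ π {z | f z.1 = i ∧ f z.2 = i})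
    (g : ι → ℝ≥0∞) :
    ∫⁻ z, (if f z.1 ≠ f z.2 then g (f z.1) else 0) ∂π ≤
      ∑' i, g i * (μ (f ⁻¹' {i}) - ν (f ⁻¹' {i})) := by
  have hF : ∀ i, MeasurableSet (f ⁻¹' {i}) := fun i => hf (measurableSet_singleton i)
  have hA : ∀ i, MeasurableSet {z : X × X | f z.1 = i} := fun i => measurable_fst (hF i)
  have hB : ∀ i, MeasurableSet {z : X × X | f z.1 = i ∧ f z.2 = i} := fun i =>
    (hA i).inter (measurable_snd (hF i))
  have hpt : ∀ z : X × X, (if f z.1 ≠ f z.2 then g (f z.1) else 0) =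
      ∑' i, ({z : X × X | f z.1 = i} \ {z | f z.1 = i ∧ f z.2 = i}).indicator (fun _ => g i) z := by
    intro z
    rw [tsum_eq_single (f z.1)]
    · by_cases hz : f z.1 = f z.2
      · simp [hz]
      · simp [hz, Ne.symm hz]
    · intro j hj
      simp [hj.symm]
  simp_rw [hpt]
  rw [lintegral_tsum fun i =>
    (measurable_const.indicator ((hA i).diff (hB i))).aemeasurable]
  refine ENNReal.tsum_le_tsum fun i => ?_
  have hsub : {z : X × X | f z.1 = i ∧ f z.2 = i} ⊆ {z | f z.1 = i} := fun z hz => hz.1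
  rw [lintegral_indicator_const ((hA i).diff (hB i)),
    measure_sdiff hsub (hB i).nullMeasurableSet (measure_ne_top _ _)]
  refine mul_le_mul_right ?_ _
  have e : π {z | f z.1 = i} = μ (f ⁻¹' {i}) := by
    rw [← hπ, Measure.fst_apply (hF i)]
    rfl
  rw [e]
  refine (tsub_le_tsub_left (h i) _).trans ?_
  rcases le_total (μ (f ⁻¹' {i})) (ν (f ⁻¹' {i})) with hle | hle
  · rw [min_eq_left hle]; simp
  · rw [min_eq_right hle]

/-- The mirror image of `lintegral_ite_ne_le`. -/
theorem lintegral_ite_ne_le' {X ι : Type*} [MeasurableSpace X] [MeasurableSpace ι]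
    [MeasurableSingletonClass ι] [Countable ι] [DecidableEq ι] {μ ν : Measure X}
    {π : Measure (X × X)} [IsFiniteMeasure π]
    (hπ : π.snd = ν) {f : X → ι} (hf : Measurable f)
    (h : ∀ i, min (μ (f ⁻¹' {i})) (ν (f ⁻¹' {i})) ≤ π {z | f z.1 = i ∧ f z.2 = i})
    (g : ι → ℝ≥0∞) :
    ∫⁻ z, (if f z.1 ≠ f z.2 then g (f z.2) else 0) ∂π ≤
      ∑' i, g i * (ν (f ⁻¹' {i}) - μ (f ⁻¹' {i})) := by
  have hswap : (π.map Prod.swap).fst = ν := by rw [Measure.fst_map_swap, hπ]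
  have h' : ∀ i, min (ν (f ⁻¹' {i})) (μ (f ⁻¹' {i})) ≤
      π.map Prod.swap {z | f z.1 = i ∧ f z.2 = i} := by
    intro i
    have hm : MeasurableSet {z : X × X | f z.1 = i ∧ f z.2 = i} :=
      (measurable_fst (hf (measurableSet_singleton i))).inter
        (measurable_snd (hf (measurableSet_singleton i)))
    rw [Measure.map_apply measurable_swap hm, min_comm]
    refine (h i).trans (measure_mono fun z hz => ?_)
    exact ⟨hz.2, hz.1⟩
  refine le_trans (le_of_eq ?_) (lintegral_ite_ne_le hswap hf h' g)
  have hme : (π.map Prod.swap) = π.map MeasurableEquiv.prodComm := rfl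
  rw [hme, lintegral_map_equiv]
  refine lintegral_congr fun z => ?_
  change _ = if f z.2 ≠ f z.1 then g (f z.2) else 0
  simp only [ne_comm]

/-! ### Discrepancy of half-open boxes -/

theorem abs_measureReal_sub_le_one {X : Type*} [MeasurableSpace X] (μ ν : Measure X)
    [IsProbabilityMeasure μ] [IsProbabilityMeasure ν] (A : Set X) :
    |μ.real A - ν.real A| ≤ 1 := by
  have h1 : μ.real A ≤ 1 := measureReal_le_one
  have h2 : ν.real A ≤ 1 := measureReal_le_one
  have h3 : 0 ≤ μ.real A := measureReal_nonneg
  have h4 : 0 ≤ ν.real A := measureReal_nonneg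
  rw [abs_le]
  constructor <;> linarith

theorem uniformDiscrepancy_le_one {d : ℕ} (μ ν : Measure (Fin d → ℝ)) [IsProbabilityMeasure μ]
    [IsProbabilityMeasure ν] : uniformDiscrepancy μ ν ≤ 1 :=
  iSup₂_le fun _ _ => ENNReal.ofReal_le_one.2 (abs_measureReal_sub_le_one μ ν _)

theorem ksDistance_le_one {d : ℕ} (μ ν : Measure (Fin d → ℝ)) [IsProbabilityMeasure μ]
    [IsProbabilityMeasure ν] : ksDistance μ ν ≤ 1 :=
  iSup_le fun _ => ENNReal.ofReal_le_one.2 (abs_measureReal_sub_le_one μ ν _)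

theorem abs_measureReal_Icc_sub_le {d : ℕ} (μ ν : Measure (Fin d → ℝ)) [IsProbabilityMeasure μ]
    [IsProbabilityMeasure ν] (x y : Fin d → ℝ) :
    |μ.real (Set.Icc x y) - ν.real (Set.Icc x y)| ≤ (uniformDiscrepancy μ ν).toReal := by
  rw [← ENNReal.ofReal_le_iff_le_toReal
    ((uniformDiscrepancy_le_one μ ν).trans_lt ENNReal.one_lt_top).ne]
  exact le_iSup₂ (f := fun x y : Fin d → ℝ =>
    ENNReal.ofReal |μ.real (Set.Icc x y) - ν.real (Set.Icc x y)|) x y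

theorem abs_measureReal_Iic_sub_le {d : ℕ} (μ ν : Measure (Fin d → ℝ)) [IsProbabilityMeasure μ]
    [IsProbabilityMeasure ν] (x : Fin d → ℝ) :
    |μ.real (Set.Iic x) - ν.real (Set.Iic x)| ≤ (ksDistance μ ν).toReal := by
  rw [← ENNReal.ofReal_le_iff_le_toReal ((ksDistance_le_one μ ν).trans_lt ENNReal.one_lt_top).ne]
  exact le_iSup (fun x : Fin d → ℝ =>
    ENNReal.ofReal |μ.real (Set.Iic x) - ν.real (Set.Iic x)|) x

/-- The set here is the lower orthant below `y`, cut off below at `x` in the directions of `S`.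
Adding a direction to `S` turns it into a difference of two such sets, which doubles the
discrepancy. -/
theorem abs_measureReal_cut_orthant_sub_le {d : ℕ} (μ ν : Measure (Fin d → ℝ))
    [IsProbabilityMeasure μ] [IsProbabilityMeasure ν] {δ : ℝ}
    (h : ∀ x, |μ.real (Set.Iic x) - ν.real (Set.Iic x)| ≤ δ) (x : Fin d → ℝ)
    (S : Finset (Fin d)) (y : Fin d → ℝ) :
    |μ.real {z | z ≤ y ∧ ∀ i ∈ S, x i < z i} - ν.real {z | z ≤ y ∧ ∀ i ∈ S, x i < z i}| ≤
      2 ^ S.card * δ := by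
  induction S using Finset.induction_on generalizing y with
  | empty => simpa [Set.Iic] using h y
  | insert j S hj ih =>
    have hm : ∀ y : Fin d → ℝ, MeasurableSet {z : Fin d → ℝ | z ≤ y ∧ ∀ i ∈ S, x i < z i} := by
      intro y
      refine measurableSet_Iic.inter ?_
      have : {z : Fin d → ℝ | ∀ i ∈ S, x i < z i} = ⋂ i ∈ S, {z | x i < z i} := by
        ext; simp
      change MeasurableSet {z : Fin d → ℝ | ∀ i ∈ S, x i < z i}
      rw [this]
      exact Finset.measurableSet_biInter _ fun i _ =>
        measurableSet_lt measurable_const (measurable_pi_apply i)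
    -- the part of the set with `z j ≤ x j` is a set of the same kind, with a smaller corner `y'`
    let y' := Function.update y j (min (x j) (y j))
    have hy' : y' ≤ y := by
      intro i
      by_cases hi : i = j
      · subst hi; simp [y']
      · simp [y', hi]
    have hset : {z : Fin d → ℝ | z ≤ y ∧ ∀ i ∈ insert j S, x i < z i} =
        {z | z ≤ y ∧ ∀ i ∈ S, x i < z i} \ {z | z ≤ y' ∧ ∀ i ∈ S, x i < z i} := by
      ext z
      simp only [Finset.mem_insert, forall_eq_or_imp, Set.mem_ofPred_eq, Set.mem_sdiff, not_and]
      constructor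
      · rintro ⟨h1, h2, h3⟩
        refine ⟨⟨h1, h3⟩, fun h4 => absurd (h4 j) ?_⟩
        simp [y', h2]
      · rintro ⟨⟨h1, h3⟩, h4⟩
        refine ⟨h1, ?_, h3⟩
        by_contra hlt
        refine h4 (fun i => ?_) h3
        by_cases hi : i = j
        · subst hi; simpa [y'] using ⟨not_lt.1 hlt, h1 i⟩
        · simpa [y', hi] using h1 i
    have hsub : {z : Fin d → ℝ | z ≤ y' ∧ ∀ i ∈ S, x i < z i} ⊆
        {z | z ≤ y ∧ ∀ i ∈ S, x i < z i} := fun z hz => ⟨hz.1.trans hy', hz.2⟩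
    rw [hset, measureReal_sdiff hsub (hm _), measureReal_sdiff hsub (hm _),
      Finset.card_insert_of_notMem hj, pow_succ]
    have h1 := abs_le.1 (ih y)
    have h2 := abs_le.1 (ih y')
    rw [abs_le]
    constructor <;> linarith [h1.1, h1.2, h2.1, h2.2]

/-- A closed box is the decreasing limit of boxes that are open below, and each of these is reached
from lower orthants by cutting in `d` directions. -/
theorem uniformDiscrepancy_le_two_pow_mul_ksDistance {d : ℕ} (μ ν : Measure (Fin d → ℝ))
    [IsProbabilityMeasure μ] [IsProbabilityMeasure ν] :
    uniformDiscrepancy μ ν ≤ 2 ^ d * ksDistance μ ν := by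
  have htop : ksDistance μ ν ≠ ∞ := ((ksDistance_le_one μ ν).trans_lt ENNReal.one_lt_top).ne
  refine iSup₂_le fun x y => ?_
  have key : |μ.real (Set.Icc x y) - ν.real (Set.Icc x y)| ≤
      2 ^ d * (ksDistance μ ν).toReal := by
    let A : ℕ → Set (Fin d → ℝ) := fun k =>
      {z | z ≤ y ∧ ∀ i ∈ Finset.univ, x i - 1 / ((k : ℝ) + 1) < z i}
    have hA : ⋂ k, A k = Set.Icc x y := by
      ext z
      simp only [A, Set.mem_iInter, Set.mem_ofPred_eq, Finset.mem_univ, true_imp_iff, Set.mem_Icc]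
      constructor
      · intro hz
        refine ⟨fun i => ?_, (hz 0).1⟩
        have hlim : Tendsto (fun k : ℕ => x i - 1 / ((k : ℝ) + 1)) atTop (𝓝 (x i - 0)) :=
          tendsto_const_nhds.sub tendsto_one_div_add_atTop_nhds_zero_nat
        rw [sub_zero] at hlim
        exact le_of_tendsto' hlim fun k => ((hz k).2 i).le
      · rintro ⟨h1, h2⟩ k
        refine ⟨h2, fun i => ?_⟩
        have : 0 < 1 / ((k : ℝ) + 1) := Nat.one_div_pos_of_nat
        linarith [h1 i]
    have hanti : Antitone A := by
      intro k l hkl z hz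
      refine ⟨hz.1, fun i hi => lt_of_le_of_lt ?_ (hz.2 i hi)⟩
      have := Nat.one_div_le_one_div (α := ℝ) hkl
      linarith
    have hm : ∀ k, MeasurableSet (A k) := by
      intro k
      have : A k = Set.Iic y ∩ ⋂ i, {z | x i - 1 / ((k : ℝ) + 1) < z i} := by
        ext; simp [A]
      rw [this]
      exact measurableSet_Iic.inter (MeasurableSet.iInter fun i =>
        measurableSet_lt measurable_const (measurable_pi_apply i))
    have hlim : ∀ (m : Measure (Fin d → ℝ)) [IsProbabilityMeasure m],
        Tendsto (fun k => m.real (A k)) atTop (𝓝 (m.real (Set.Icc x y))) := by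
      intro m _
      have := tendsto_measure_iInter_atTop (μ := m) (fun k => (hm k).nullMeasurableSet) hanti
        ⟨0, measure_ne_top _ _⟩
      rw [hA] at this
      exact (ENNReal.tendsto_toReal (measure_ne_top _ _)).comp this
    refine le_of_tendsto' ((hlim μ).sub (hlim ν)).abs fun k => ?_
    simpa only [Finset.card_univ, Fintype.card_fin] using
      abs_measureReal_cut_orthant_sub_le μ ν (abs_measureReal_Iic_sub_le μ ν)
        (fun i => x i - 1 / ((k : ℝ) + 1)) Finset.univ y
  calc _ ≤ ENNReal.ofReal (2 ^ d * (ksDistance μ ν).toReal) := ENNReal.ofReal_le_ofReal key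
    _ = 2 ^ d * ksDistance μ ν := by
      rw [ENNReal.ofReal_mul (by positivity), ENNReal.ofReal_toReal htop,
        ENNReal.ofReal_pow (by norm_num), ENNReal.ofReal_ofNat]

/-- The half-open box `∏ [a i, b i)`. -/
def halfOpenBox {d : ℕ} (a b : Fin d → ℝ) : Set (Fin d → ℝ) :=
  {x | ∀ i, a i ≤ x i ∧ x i < b i}

theorem measurableSet_halfOpenBox {d : ℕ} (a b : Fin d → ℝ) :
    MeasurableSet (halfOpenBox a b) := by
  have : halfOpenBox a b = ⋂ i, {x | a i ≤ x i ∧ x i < b i} := by ext; simp [halfOpenBox]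
  rw [this]
  exact MeasurableSet.iInter fun i =>
    (measurableSet_le measurable_const (measurable_pi_apply i)).inter
      (measurableSet_lt (measurable_pi_apply i) measurable_const)

theorem halfOpenBox_inter {d : ℕ} (a b a' b' : Fin d → ℝ) :
    halfOpenBox a b ∩ halfOpenBox a' b' = halfOpenBox (a ⊔ a') (b ⊓ b') := by
  ext x
  simp only [halfOpenBox, Set.mem_inter_iff, Set.mem_ofPred_eq, Pi.sup_apply, Pi.inf_apply,
    sup_le_iff, lt_inf_iff]
  exact ⟨fun h i => ⟨⟨(h.1 i).1, (h.2 i).1⟩, (h.1 i).2, (h.2 i).2⟩,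
    fun h => ⟨fun i => ⟨(h i).1.1, (h i).2.1⟩, fun i => ⟨(h i).1.2, (h i).2.2⟩⟩⟩

/-- A half-open box is an increasing union of closed boxes. -/
theorem abs_measureReal_halfOpenBox_sub_le {d : ℕ} (μ ν : Measure (Fin d → ℝ))
    [IsProbabilityMeasure μ] [IsProbabilityMeasure ν] (a b : Fin d → ℝ) :
    |μ.real (halfOpenBox a b) - ν.real (halfOpenBox a b)| ≤ (uniformDiscrepancy μ ν).toReal := by
  let A : ℕ → Set (Fin d → ℝ) := fun k => Set.Icc a (fun i => b i - 1 / ((k : ℝ) + 1))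
  have hA : ⋃ k, A k = halfOpenBox a b := by
    ext z
    simp only [A, Set.mem_iUnion, Set.mem_Icc, halfOpenBox, Set.mem_ofPred_eq]
    constructor
    · rintro ⟨k, h1, h2⟩ i
      have h3 : 0 < 1 / ((k : ℝ) + 1) := Nat.one_div_pos_of_nat
      have h4 : z i ≤ b i - 1 / ((k : ℝ) + 1) := h2 i
      exact ⟨h1 i, by linarith⟩
    · intro hz
      have hev : ∀ i, ∀ᶠ k : ℕ in atTop, z i ≤ b i - 1 / ((k : ℝ) + 1) := by
        intro i
        have hlim : Tendsto (fun k : ℕ => b i - 1 / ((k : ℝ) + 1)) atTop (𝓝 (b i - 0)) :=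
          tendsto_const_nhds.sub tendsto_one_div_add_atTop_nhds_zero_nat
        rw [sub_zero] at hlim
        exact hlim.eventually_const_le (hz i).2
      obtain ⟨k, hk⟩ := (eventually_all.2 hev).exists
      exact ⟨k, fun i => (hz i).1, hk⟩
  have hmono : Monotone A := by
    intro k l hkl z hz
    refine ⟨hz.1, fun i => (hz.2 i).trans ?_⟩
    have := Nat.one_div_le_one_div (α := ℝ) hkl
    change b i - 1 / ((k : ℝ) + 1) ≤ b i - 1 / ((l : ℝ) + 1)
    linarith
  have hlim : ∀ (m : Measure (Fin d → ℝ)) [IsProbabilityMeasure m],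
      Tendsto (fun k => m.real (A k)) atTop (𝓝 (m.real (halfOpenBox a b))) := by
    intro m _
    have := tendsto_measure_iUnion_atTop (μ := m) hmono
    rw [hA] at this
    exact (ENNReal.tendsto_toReal (measure_ne_top _ _)).comp this
  exact le_of_tendsto' ((hlim μ).sub (hlim ν)).abs fun k => abs_measureReal_Icc_sub_le μ ν _ _

/-! ### Geometric series of minima -/

theorem exists_tsum_geometric_le {c : ℝ} (hc : 0 < c) :
    ∃ C : ℝ, 0 < C ∧ ∑' n : ℕ, ENNReal.ofReal (2 ^ (-c * n)) ≤ ENNReal.ofReal C := by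
  have hr : (2 : ℝ) ^ (-c) < 1 := Real.rpow_lt_one_of_one_lt_of_neg (by norm_num) (by linarith)
  have hs : Summable fun n : ℕ => ((2 : ℝ) ^ (-c)) ^ n :=
    summable_geometric_of_lt_one (by positivity) hr
  have heq : ∀ n : ℕ, (2 : ℝ) ^ (-c * n) = ((2 : ℝ) ^ (-c)) ^ n := fun n => by
    rw [Real.rpow_mul (by norm_num), Real.rpow_natCast]
  refine ⟨∑' n : ℕ, ((2 : ℝ) ^ (-c)) ^ n, ?_, ?_⟩
  · exact hs.tsum_pos (fun n => by positivity) 0 (by simp)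
  · simp_rw [heq]
    rw [ENNReal.ofReal_tsum_of_nonneg (fun n => by positivity) hs]

/-- A sum of minima of an increasing and a decreasing geometric sequence is comparable to the common
value of the two sequences at the real point where they cross, uniformly in that point. -/
theorem exists_tsum_min_le {a b : ℝ} (ha : 0 < a) (hb : 0 < b) :
    ∃ C : ℝ, 0 < C ∧ ∀ x y : ℝ, 0 ≤ x → 0 ≤ y →
      ∑' k : ℕ, ENNReal.ofReal (min (x * 2 ^ (a * k)) (y * 2 ^ (-b * k))) ≤
        ENNReal.ofReal (C * (x ^ (b / (a + b)) * y ^ (a / (a + b)))) := by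
  have hab : 0 < a + b := by linarith
  set c := min a b with hc_def
  have hc : 0 < c := lt_min ha hb
  set r : ℝ := 2 ^ (-c) with hr_def
  have hr0 : 0 < r := by positivity
  have hr : r < 1 := Real.rpow_lt_one_of_one_lt_of_neg (by norm_num) (by linarith)
  have hsn : Summable fun n : ℕ => r ^ n := summable_geometric_of_lt_one hr0.le hr
  have hs : Summable fun k : ℤ => r ^ k.natAbs :=
    Summable.of_nat_of_neg (by simpa using hsn) (by simpa using hsn)
  set S := ∑' k : ℤ, r ^ k.natAbs
  have hS : 0 < S := hs.tsum_pos (fun n => by positivity) 0 (by simp)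
  refine ⟨2 ^ c * S, by positivity, fun x y hx hy => ?_⟩
  rcases hx.eq_or_lt with rfl | hx
  · simp
  rcases hy.eq_or_lt with rfl | hy
  · simp
  -- The two terms cross at `k = τ`, where their common value is `G`.
  set τ := Real.logb 2 (y / x) / (a + b) with hτ
  set G := x ^ (b / (a + b)) * y ^ (a / (a + b)) with hG
  have hyx : y = x * 2 ^ ((a + b) * τ) := by
    rw [hτ, mul_div_cancel₀ _ hab.ne', Real.rpow_logb (by norm_num) (by norm_num) (by positivity)]
    field_simp
  have hGx : G = x * 2 ^ (a * τ) := by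
    rw [hG, hyx, Real.mul_rpow hx.le (by positivity), ← mul_assoc, ← Real.rpow_add hx,
      ← Real.rpow_mul (by norm_num)]
    congr 2
    · rw [← add_div, add_comm b a, div_self hab.ne', Real.rpow_one]
    · field_simp
  have hGpos : 0 < G := by positivity
  clear_value G
  have hterm : ∀ k : ℤ, min (x * 2 ^ (a * k)) (y * 2 ^ (-b * k)) ≤
      2 ^ c * G * r ^ (k - ⌊τ⌋).natAbs := by
    intro k
    have h1 : x * 2 ^ (a * k) = G * 2 ^ (a * (k - τ)) := by
      rw [hGx, mul_assoc, ← Real.rpow_add (by norm_num)]; ring_nf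
    have h2 : y * 2 ^ (-b * k) = G * 2 ^ (-b * (k - τ)) := by
      rw [hGx, hyx, mul_assoc, mul_assoc, ← Real.rpow_add (by norm_num),
        ← Real.rpow_add (by norm_num)]; ring_nf
    have h3 : r ^ (k - ⌊τ⌋).natAbs = 2 ^ (-c * |(k : ℝ) - ⌊τ⌋|) := by
      rw [hr_def, ← Real.rpow_natCast, ← Real.rpow_mul (by norm_num), Nat.cast_natAbs]
      push_cast; rfl
    rw [h1, h2, ← mul_min_of_nonneg _ _ hGpos.le, h3, mul_comm (2 ^ c) G, mul_assoc,
      ← Real.rpow_add (by norm_num)]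
    gcongr
    -- replacing `τ` by its integer part costs at most the factor `2 ^ c`
    have hdist : |(k : ℝ) - ⌊τ⌋| ≤ |k - τ| + 1 := by
      have h4 : |τ - ⌊τ⌋| ≤ 1 := by
        rw [abs_of_nonneg (sub_nonneg.2 (Int.floor_le τ))]
        linarith [Int.lt_floor_add_one τ]
      linarith [abs_sub_le (k : ℝ) τ ⌊τ⌋]
    have hexp : ∀ t : ℝ, min ((2 : ℝ) ^ (a * t)) (2 ^ (-b * t)) ≤ 2 ^ (-c * |t|) := by
      intro t
      rcases le_total 0 t with ht | ht
      · refine (min_le_right _ _).trans (Real.rpow_le_rpow_of_exponent_le (by norm_num) ?_)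
        rw [abs_of_nonneg ht]
        nlinarith [min_le_right a b]
      · refine (min_le_left _ _).trans (Real.rpow_le_rpow_of_exponent_le (by norm_num) ?_)
        rw [abs_of_nonpos ht]
        nlinarith [min_le_left a b]
    refine (hexp _).trans (Real.rpow_le_rpow_of_exponent_le (by norm_num) ?_)
    nlinarith
  calc ∑' k : ℕ, ENNReal.ofReal (min (x * 2 ^ (a * k)) (y * 2 ^ (-b * k)))
      ≤ ∑' k : ℤ, ENNReal.ofReal (min (x * 2 ^ (a * k)) (y * 2 ^ (-b * k))) := by
        have := ENNReal.tsum_comp_le_tsum_of_injective (Nat.cast_injective (R := ℤ))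
          fun k : ℤ => ENNReal.ofReal (min (x * 2 ^ (a * k)) (y * 2 ^ (-b * k)))
        simpa using this
    _ ≤ ∑' k : ℤ, ENNReal.ofReal (2 ^ c * G * r ^ (k - ⌊τ⌋).natAbs) :=
        ENNReal.tsum_le_tsum fun k => ENNReal.ofReal_le_ofReal (hterm k)
    _ = ∑' k : ℤ, ENNReal.ofReal (2 ^ c * G * r ^ k.natAbs) :=
        (Equiv.subRight ⌊τ⌋).tsum_eq fun k : ℤ => ENNReal.ofReal (2 ^ c * G * r ^ k.natAbs)
    _ = ENNReal.ofReal (2 ^ c * S * G) := by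
        rw [← ENNReal.ofReal_tsum_of_nonneg (fun n => by positivity) (hs.mul_left _), tsum_mul_left]
        congr 1
        ring

/-- When `p < d q / (q + d)`, summing over the levels `l` first leaves a convergent geometric series
over the shells `n`. -/
theorem exists_double_tsum_le_of_lt {p q d : ℝ} (hp : 0 < p) (hq : 0 < q) (hd : 0 < d)
    (h : p < d * q / (q + d)) :
    ∃ C : ℝ, 0 < C ∧ ∀ u v : ℝ, 0 ≤ u → 0 ≤ v →
      ∑' l : ℕ, ∑' n : ℕ, ENNReal.ofReal (2 ^ (-p * l) * (2 ^ (p * n) *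
        min (u * 2 ^ (d * l)) (v * 2 ^ (-q * n)))) ≤
        ENNReal.ofReal (C * (u ^ (p / d) * v ^ (1 - p / d))) := by
  have h' : p * (q + d) < d * q := (lt_div_iff₀ (by linarith)).1 h
  have hpd : p < d := by nlinarith
  obtain ⟨C₁, hC₁, H₁⟩ := exists_tsum_min_le (sub_pos.2 hpd) hp
  have hc : 0 < q * (1 - p / d) - p := by
    have : q * (1 - p / d) - p = (d * q - p * (q + d)) / d := by field_simp; ring
    rw [this]; exact div_pos (by linarith) hd
  obtain ⟨C₂, hC₂, H₂⟩ := exists_tsum_geometric_le hc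
  refine ⟨C₁ * C₂, by positivity, fun u v hu hv => ?_⟩
  rw [ENNReal.tsum_comm]
  have hn : ∀ n : ℕ, ∑' l : ℕ, ENNReal.ofReal (2 ^ (-p * l) * (2 ^ (p * n) *
        min (u * 2 ^ (d * l)) (v * 2 ^ (-q * n)))) ≤
      ENNReal.ofReal (C₁ * (u ^ (p / d) * v ^ (1 - p / d))) *
        ENNReal.ofReal (2 ^ (-(q * (1 - p / d) - p) * n)) := by
    intro n
    have e : ∀ l : ℕ, ENNReal.ofReal (2 ^ (-p * l) * (2 ^ (p * n) *
        min (u * 2 ^ (d * l)) (v * 2 ^ (-q * n)))) = ENNReal.ofReal (2 ^ (p * n)) *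
        ENNReal.ofReal (min (u * 2 ^ ((d - p) * l)) ((v * 2 ^ (-q * n)) * 2 ^ (-p * l))) := by
      intro l
      rw [← ENNReal.ofReal_mul (by positivity), mul_left_comm,
        mul_min_of_nonneg _ _ (by positivity : (0 : ℝ) ≤ 2 ^ (-p * l))]
      congr 3
      · rw [mul_left_comm, ← Real.rpow_add (by norm_num)]; ring_nf
      · ring
    simp_rw [e]
    rw [ENNReal.tsum_mul_left]
    refine (mul_le_mul_right (H₁ u _ hu (by positivity)) _).trans ?_
    rw [← ENNReal.ofReal_mul (by positivity), ← ENNReal.ofReal_mul (by positivity)]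
    refine ENNReal.ofReal_le_ofReal (le_of_eq ?_)
    rw [show (d - p) + p = d by ring, show (d - p) / d = 1 - p / d by field_simp,
      Real.mul_rpow hv (by positivity), ← Real.rpow_mul (by norm_num),
      show -(q * (1 - p / d) - p) * n = p * n + -q * n * (1 - p / d) by ring,
      Real.rpow_add (by norm_num)]
    ring
  refine (ENNReal.tsum_le_tsum hn).trans ?_
  rw [ENNReal.tsum_mul_left]
  refine (mul_le_mul_right H₂ _).trans ?_
  rw [← ENNReal.ofReal_mul (by positivity)]
  exact ENNReal.ofReal_le_ofReal (le_of_eq (by ring))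

/-- When `p > d q / (q + d)`, summing over the shells `n` first leaves a convergent geometric series
over the levels `l`. -/
theorem exists_double_tsum_le_of_gt {p q d : ℝ} (hp : 0 < p) (hpq : p < q) (hd : 0 < d)
    (h : d * q / (q + d) < p) :
    ∃ C : ℝ, 0 < C ∧ ∀ u v : ℝ, 0 ≤ u → 0 ≤ v →
      ∑' l : ℕ, ∑' n : ℕ, ENNReal.ofReal (2 ^ (-p * l) * (2 ^ (p * n) *
        min (u * 2 ^ (d * l)) (v * 2 ^ (-q * n)))) ≤
        ENNReal.ofReal (C * (u ^ (1 - p / q) * v ^ (p / q))) := by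
  have hq : 0 < q := hp.trans hpq
  have h' : d * q < p * (q + d) := (div_lt_iff₀ (by linarith)).1 h
  obtain ⟨C₁, hC₁, H₁⟩ := exists_tsum_min_le hp (sub_pos.2 hpq)
  have hc : 0 < p - d * (1 - p / q) := by
    have : p - d * (1 - p / q) = (p * (q + d) - d * q) / q := by field_simp; ring
    rw [this]; exact div_pos (by linarith) hq
  obtain ⟨C₂, hC₂, H₂⟩ := exists_tsum_geometric_le hc
  refine ⟨C₁ * C₂, by positivity, fun u v hu hv => ?_⟩
  have hl : ∀ l : ℕ, ∑' n : ℕ, ENNReal.ofReal (2 ^ (-p * l) * (2 ^ (p * n) *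
        min (u * 2 ^ (d * l)) (v * 2 ^ (-q * n)))) ≤
      ENNReal.ofReal (C₁ * (u ^ (1 - p / q) * v ^ (p / q))) *
        ENNReal.ofReal (2 ^ (-(p - d * (1 - p / q)) * l)) := by
    intro l
    have e : ∀ n : ℕ, ENNReal.ofReal (2 ^ (-p * l) * (2 ^ (p * n) *
        min (u * 2 ^ (d * l)) (v * 2 ^ (-q * n)))) = ENNReal.ofReal (2 ^ (-p * l)) *
        ENNReal.ofReal (min ((u * 2 ^ (d * l)) * 2 ^ (p * n)) (v * 2 ^ (-(q - p) * n))) := by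
      intro n
      rw [← ENNReal.ofReal_mul (by positivity),
        mul_min_of_nonneg _ _ (by positivity : (0 : ℝ) ≤ 2 ^ (p * n))]
      congr 3
      · ring
      · rw [mul_left_comm, ← Real.rpow_add (by norm_num)]; ring_nf
    simp_rw [e]
    rw [ENNReal.tsum_mul_left]
    refine (mul_le_mul_right (H₁ _ v (by positivity) hv) _).trans ?_
    rw [← ENNReal.ofReal_mul (by positivity), ← ENNReal.ofReal_mul (by positivity)]
    refine ENNReal.ofReal_le_ofReal (le_of_eq ?_)
    rw [show p + (q - p) = q by ring, show (q - p) / q = 1 - p / q by field_simp,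
      Real.mul_rpow hu (by positivity), ← Real.rpow_mul (by norm_num),
      show -(p - d * (1 - p / q)) * l = -p * l + d * l * (1 - p / q) by ring,
      Real.rpow_add (by norm_num)]
    ring
  refine (ENNReal.tsum_le_tsum hl).trans ?_
  rw [ENNReal.tsum_mul_left]
  refine (mul_le_mul_right H₂ _).trans ?_
  rw [← ENNReal.ofReal_mul (by positivity)]
  exact ENNReal.ofReal_le_ofReal (le_of_eq (by ring))

/-! ### Norms on `ℝ ^ d` -/

theorem Seminorm.exists_le_mul_norm {d : ℕ} (N : Seminorm ℝ (Fin d → ℝ)) :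
    ∃ C : ℝ, 0 < C ∧ ∀ x, N x ≤ C * ‖x‖ := by
  refine ⟨1 + ∑ i, N (Pi.single i 1), ?_, fun x => ?_⟩
  · have : 0 ≤ ∑ i, N (Pi.single i 1) := Finset.sum_nonneg fun i _ => apply_nonneg N _
    linarith
  · calc N x = N (∑ i, x i • Pi.single i (1 : ℝ)) := by
          congr 1
          exact pi_eq_sum_univ' x
      _ ≤ ∑ i, N (x i • Pi.single i (1 : ℝ)) :=
          Finset.le_sum_of_subadditive N (map_zero N).le (map_add_le_add N) _ _
      _ ≤ ∑ i, ‖x‖ * N (Pi.single i (1 : ℝ)) := by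
          refine Finset.sum_le_sum fun i _ => ?_
          rw [map_smul_eq_mul]
          exact mul_le_mul_of_nonneg_right (norm_le_pi_norm x i) (apply_nonneg N _)
      _ ≤ (1 + ∑ i, N (Pi.single i 1)) * ‖x‖ := by
          rw [← Finset.mul_sum, add_mul, one_mul, mul_comm]
          linarith [norm_nonneg x]

theorem Seminorm.continuous_of_pi {d : ℕ} (N : Seminorm ℝ (Fin d → ℝ)) : Continuous N := by
  obtain ⟨C, hC, hle⟩ := N.exists_le_mul_norm
  lift C to NNReal using hC.le
  exact Seminorm.continuous_of_le (q := C • normSeminorm ℝ (Fin d → ℝ))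
    (continuous_const.mul continuous_norm) fun x => hle x

theorem Seminorm.exists_norm_le_mul {d : ℕ} (N : Seminorm ℝ (Fin d → ℝ))
    (hN : ∀ x, N x = 0 → x = 0) : ∃ c : ℝ, 0 < c ∧ ∀ x, ‖x‖ ≤ c * N x := by
  have hcont := N.continuous_of_pi
  rcases (Metric.sphere (0 : Fin d → ℝ) 1).eq_empty_or_nonempty with he | hne
  · refine ⟨1, one_pos, fun x => ?_⟩
    have hx : x = 0 := by
      by_contra hx
      have : ‖x‖⁻¹ • x ∈ Metric.sphere (0 : Fin d → ℝ) 1 := by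
        simp [norm_smul, norm_ne_zero_iff.2 hx]
      simp [he] at this
    simp [hx]
  · obtain ⟨x₀, hx₀, hmin⟩ := (isCompact_sphere (0 : Fin d → ℝ) 1).exists_isMinOn hne
      hcont.continuousOn
    have hpos : 0 < N x₀ := by
      refine lt_of_le_of_ne (apply_nonneg N _) fun h => ?_
      rw [hN x₀ h.symm] at hx₀
      simp at hx₀
    refine ⟨(N x₀)⁻¹, inv_pos.2 hpos, fun x => ?_⟩
    rcases eq_or_ne x 0 with rfl | hx
    · simp
    have hnorm : 0 < ‖x‖ := norm_pos_iff.2 hx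
    have hmem : ‖x‖⁻¹ • x ∈ Metric.sphere (0 : Fin d → ℝ) 1 := by
      simp [norm_smul, hnorm.ne']
    have h1 : N x₀ ≤ N (‖x‖⁻¹ • x) := hmin hmem
    rw [map_smul_eq_mul, norm_inv, norm_norm, inv_mul_eq_div, le_div_iff₀ hnorm] at h1
    rwa [inv_mul_eq_div, le_div_iff₀ hpos, mul_comm]

/-! ### Dyadic shells and cells -/

/-- The half-open cube `[-2 ^ n, 2 ^ n) ^ d`. -/
def dyadicCube (d n : ℕ) : Set (Fin d → ℝ) :=
  halfOpenBox (fun _ => -2 ^ n) (fun _ => 2 ^ n)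

theorem dyadicCube_mono {d : ℕ} : Monotone (dyadicCube d) := by
  intro m n hmn x hx i
  have h : (2 : ℝ) ^ m ≤ 2 ^ n := pow_le_pow_right₀ (by norm_num) hmn
  exact ⟨(neg_le_neg h).trans (hx i).1, (hx i).2.trans_le h⟩

theorem mem_dyadicCube_of_norm_lt {d n : ℕ} {x : Fin d → ℝ} (h : ‖x‖ < 2 ^ n) :
    x ∈ dyadicCube d n := fun i =>
  have := abs_lt.1 ((norm_le_pi_norm x i).trans_lt h)
  ⟨this.1.le, this.2⟩

theorem norm_le_of_mem_dyadicCube {d n : ℕ} {x : Fin d → ℝ} (h : x ∈ dyadicCube d n) :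
    ‖x‖ ≤ 2 ^ n :=
  (pi_norm_le_iff_of_nonneg (by positivity)).2 fun i => abs_le.2 ⟨(h i).1, (h i).2.le⟩

theorem exists_mem_dyadicCube {d : ℕ} (x : Fin d → ℝ) : ∃ n, x ∈ dyadicCube d n :=
  (pow_unbounded_of_one_lt ‖x‖ (one_lt_two)).imp fun _ => mem_dyadicCube_of_norm_lt

open Classical in
/-- The index of the dyadic shell of `x`: the least `n` with `x ∈ [-2 ^ n, 2 ^ n) ^ d`. -/
noncomputable def shell {d : ℕ} (x : Fin d → ℝ) : ℕ := Nat.find (exists_mem_dyadicCube x)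

theorem shell_le_iff {d n : ℕ} {x : Fin d → ℝ} : shell x ≤ n ↔ x ∈ dyadicCube d n := by
  classical
  rw [shell, Nat.find_le_iff]
  exact ⟨fun ⟨m, hm, hx⟩ => dyadicCube_mono hm hx, fun h => ⟨n, le_rfl, h⟩⟩

theorem norm_le_two_pow_shell {d : ℕ} (x : Fin d → ℝ) : ‖x‖ ≤ 2 ^ shell x :=
  norm_le_of_mem_dyadicCube (shell_le_iff.1 le_rfl)

theorem two_pow_le_norm_of_lt_shell {d n : ℕ} {x : Fin d → ℝ} (h : n < shell x) :
    2 ^ n ≤ ‖x‖ := by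
  by_contra hlt
  exact absurd (shell_le_iff.2 (mem_dyadicCube_of_norm_lt (not_le.1 hlt))) (not_le.2 h)

theorem measurable_shell {d : ℕ} : Measurable (shell : (Fin d → ℝ) → ℕ) := by
  classical
  exact measurable_find _ fun n => measurableSet_halfOpenBox _ _

/-- The label of the cell of `x` at level `l`: the shell of `x`, together with the position of `x`
in the grid of mesh `2 ^ n / 2 ^ l`, where `n` is the index of the shell. -/
noncomputable def dyadicCell {d : ℕ} (l : ℕ) (x : Fin d → ℝ) : ℕ × (Fin d → ℤ) :=
  (shell x, fun i => ⌊x i * 2 ^ l / 2 ^ shell x⌋)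

theorem measurable_dyadicCell {d : ℕ} (l : ℕ) :
    Measurable (dyadicCell l : (Fin d → ℝ) → ℕ × (Fin d → ℤ)) := by
  have h2 : Measurable fun x : Fin d → ℝ => (2 : ℝ) ^ shell x :=
    (measurable_of_countable fun n : ℕ => (2 : ℝ) ^ n).comp measurable_shell
  exact measurable_shell.prodMk (measurable_pi_lambda _ fun i =>
    Int.measurable_floor.comp (((measurable_pi_apply i).mul_const _).div h2))

theorem dyadicCell_eq_of_succ {d : ℕ} (l : ℕ) (x y : Fin d → ℝ)
    (h : dyadicCell (l + 1) x = dyadicCell (l + 1) y) : dyadicCell l x = dyadicCell l y := by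
  have h1 : shell x = shell y := congrArg Prod.fst h
  have hhalf : ∀ (z : Fin d → ℝ) (i : Fin d), ⌊z i * 2 ^ l / 2 ^ shell z⌋ =
      ⌊z i * 2 ^ (l + 1) / 2 ^ shell z⌋ / 2 := by
    intro z i
    have := Int.floor_div_natCast (z i * 2 ^ (l + 1) / 2 ^ shell z) 2
    rw [Nat.cast_ofNat, Nat.cast_ofNat] at this
    rw [← this, pow_succ]
    congr 1
    ring
  refine Prod.ext h1 (funext fun i => ?_)
  have h2 : ⌊x i * 2 ^ (l + 1) / 2 ^ shell x⌋ = ⌊y i * 2 ^ (l + 1) / 2 ^ shell y⌋ :=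
    congrFun (congrArg Prod.snd h) i
  change ⌊x i * 2 ^ l / 2 ^ shell x⌋ = ⌊y i * 2 ^ l / 2 ^ shell y⌋
  rw [hhalf, hhalf, h2]

theorem norm_sub_le_of_dyadicCell_eq {d l : ℕ} {x y : Fin d → ℝ}
    (h : dyadicCell l x = dyadicCell l y) : ‖x - y‖ ≤ 2 ^ shell x / 2 ^ l := by
  have h1 : shell x = shell y := congrArg Prod.fst h
  refine (pi_norm_le_iff_of_nonneg (by positivity)).2 fun i => ?_
  have h2 : ⌊x i * 2 ^ l / 2 ^ shell x⌋ = ⌊y i * 2 ^ l / 2 ^ shell y⌋ :=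
    congrFun (congrArg Prod.snd h) i
  have h3 := Int.abs_sub_lt_one_of_floor_eq_floor h2
  rw [← h1, ← sub_div, ← sub_mul, abs_div, abs_mul, abs_of_pos (by positivity : (0 : ℝ) < 2 ^ l),
    abs_of_pos (by positivity : (0 : ℝ) < 2 ^ shell x), div_lt_one (by positivity)] at h3
  rw [le_div_iff₀ (by positivity)]
  exact h3.le

theorem dyadicCell_preimage {d : ℕ} (l n : ℕ) (k : Fin d → ℤ) :
    dyadicCell l ⁻¹' {(n, k)} =
      (halfOpenBox (fun i => k i * 2 ^ n / 2 ^ l) (fun i => (k i + 1) * 2 ^ n / 2 ^ l) ∩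
        dyadicCube d n) \ {x | shell x < n} := by
  ext x
  have hcell : (∀ i, ⌊x i * 2 ^ l / 2 ^ n⌋ = k i) ↔
      x ∈ halfOpenBox (fun i => k i * 2 ^ n / 2 ^ l) (fun i => (k i + 1) * 2 ^ n / 2 ^ l) := by
    refine forall_congr' fun i => ?_
    rw [Int.floor_eq_iff, le_div_iff₀ (by positivity), div_lt_iff₀ (by positivity),
      div_le_iff₀ (by positivity), lt_div_iff₀ (by positivity)]
  rw [Set.mem_preimage, Set.mem_singleton_iff, Set.mem_sdiff, Set.mem_inter_iff, ← hcell,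
    ← shell_le_iff]
  constructor
  · intro h
    have h1 : shell x = n := congrArg Prod.fst h
    subst h1
    exact ⟨⟨fun i => congrFun (congrArg Prod.snd h) i, le_rfl⟩, fun h' => lt_irrefl (shell x) h'⟩
  · rintro ⟨⟨h1, h2⟩, h3⟩
    have h4 : shell x = n := le_antisymm h2 (not_lt.1 h3)
    subst h4
    exact Prod.ext rfl (funext h1)

/-- A dyadic cell is a half-open box, or the difference of two of them, so that its discrepancy is at
most twice that of a box. -/
theorem measure_dyadicCell_sub_le {d : ℕ} (μ ν : Measure (Fin d → ℝ)) [IsProbabilityMeasure μ]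
    [IsProbabilityMeasure ν] (l : ℕ) (i : ℕ × (Fin d → ℤ)) :
    μ (dyadicCell l ⁻¹' {i}) - ν (dyadicCell l ⁻¹' {i}) ≤
      ENNReal.ofReal (2 * (uniformDiscrepancy μ ν).toReal) := by
  obtain ⟨n, k⟩ := i
  set δ := (uniformDiscrepancy μ ν).toReal
  have hδ : 0 ≤ δ := ENNReal.toReal_nonneg
  have hbox : ∀ a b : Fin d → ℝ, |μ.real (halfOpenBox a b) - ν.real (halfOpenBox a b)| ≤ δ :=
    abs_measureReal_halfOpenBox_sub_le μ ν
  have key : μ.real (dyadicCell l ⁻¹' {(n, k)}) - ν.real (dyadicCell l ⁻¹' {(n, k)}) ≤ 2 * δ := by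
    rw [dyadicCell_preimage, dyadicCube, halfOpenBox_inter]
    generalize (fun i => (k i : ℝ) * 2 ^ n / 2 ^ l) ⊔ (fun _ => -2 ^ n) = a
    generalize (fun i => ((k i : ℝ) + 1) * 2 ^ n / 2 ^ l) ⊓ (fun _ => 2 ^ n) = b
    have h1 := abs_le.1 (hbox a b)
    rcases n with _ | n
    · have : {x : Fin d → ℝ | shell x < 0} = ∅ := by ext; simp
      rw [this, Set.sdiff_empty]
      linarith [h1.2]
    · have : {x : Fin d → ℝ | shell x < n + 1} = dyadicCube d n := by
        ext x
        rw [← shell_le_iff]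
        exact Nat.lt_succ_iff
      rw [this, dyadicCube]
      have h2 : MeasurableSet (halfOpenBox (fun _ : Fin d => -(2 : ℝ) ^ n) fun _ => 2 ^ n) :=
        measurableSet_halfOpenBox _ _
      have h3 := measureReal_inter_add_sdiff (μ := μ) (s := halfOpenBox a b) h2
      have h4 := measureReal_inter_add_sdiff (μ := ν) (s := halfOpenBox a b) h2
      rw [halfOpenBox_inter] at h3 h4
      have h5 := abs_le.1 (hbox (a ⊔ fun _ => -2 ^ n) (b ⊓ fun _ => 2 ^ n))
      linarith [h1.2, h5.1]
  rw [tsub_le_iff_left, ← ofReal_measureReal, ← ofReal_measureReal,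
    ← ENNReal.ofReal_add measureReal_nonneg (by positivity)]
  exact ENNReal.ofReal_le_ofReal (by linarith)

theorem dyadicCell_snd_mem_Ico {d l : ℕ} (x : Fin d → ℝ) (i : Fin d) :
    (dyadicCell l x).2 i ∈ Finset.Ico (-2 ^ l : ℤ) (2 ^ l) := by
  have hx : x ∈ dyadicCube d (shell x) := shell_le_iff.1 le_rfl
  have hpos : (0 : ℝ) < 2 ^ shell x := by positivity
  rw [Finset.mem_Ico]
  constructor
  · refine Int.le_floor.2 ?_
    push_cast
    rw [le_div_iff₀ hpos]
    nlinarith [(hx i).1, (by positivity : (0 : ℝ) < 2 ^ l)]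
  · refine Int.floor_lt.2 ?_
    push_cast
    rw [div_lt_iff₀ hpos]
    nlinarith [(hx i).2, (by positivity : (0 : ℝ) < 2 ^ l)]

/-- The total excess of `μ` over `ν` in the cells of one shell is bounded by the number of cells
times the discrepancy of a cell, and by the mass of the shell. -/
theorem tsum_measure_dyadicCell_sub_le {d : ℕ} (μ ν : Measure (Fin d → ℝ))
    [IsProbabilityMeasure μ] [IsProbabilityMeasure ν] (l n : ℕ) {m : ℝ}
    (hm : μ (shell ⁻¹' {n}) ≤ ENNReal.ofReal m) :
    ∑' k : Fin d → ℤ, (μ (dyadicCell l ⁻¹' {(n, k)}) - ν (dyadicCell l ⁻¹' {(n, k)})) ≤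
      ENNReal.ofReal
        (min (2 ^ (d + 1) * (uniformDiscrepancy μ ν).toReal * 2 ^ ((d : ℝ) * l)) m) := by
  set δ := (uniformDiscrepancy μ ν).toReal
  rw [ENNReal.ofReal_min]
  refine le_min ?_ ?_
  · let T : Finset (Fin d → ℤ) := Fintype.piFinset fun _ => Finset.Ico (-2 ^ l : ℤ) (2 ^ l)
    have hzero : ∀ k ∉ T, μ (dyadicCell l ⁻¹' {(n, k)}) - ν (dyadicCell l ⁻¹' {(n, k)}) = 0 := by
      intro k hk
      have : dyadicCell l ⁻¹' {(n, k)} = (∅ : Set (Fin d → ℝ)) := by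
        refine Set.eq_empty_of_forall_notMem fun x hx => hk ?_
        refine Fintype.mem_piFinset.2 fun i => ?_
        have h := dyadicCell_snd_mem_Ico (l := l) x i
        rwa [show dyadicCell l x = (n, k) from hx] at h
      simp [this]
    rw [tsum_eq_sum (s := T) fun k hk => hzero k hk]
    refine (Finset.sum_le_card_nsmul T _ _ fun k _ => measure_dyadicCell_sub_le μ ν l (n, k)).trans
      (le_of_eq ?_)
    have hcard : T.card = (2 ^ (l + 1)) ^ d := by
      rw [Fintype.card_piFinset_const, Int.card_Ico]
      congr 1
      have : (2 : ℤ) ^ l - -2 ^ l = ((2 ^ (l + 1) : ℕ) : ℤ) := by push_cast; ring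
      rw [this, Int.toNat_natCast]
    rw [hcard, nsmul_eq_mul, ← ENNReal.ofReal_natCast, ← ENNReal.ofReal_mul (by positivity)]
    congr 1
    rw [Real.rpow_mul (by norm_num), Real.rpow_natCast, Real.rpow_natCast]
    push_cast
    ring
  · calc _ ≤ ∑' k : Fin d → ℤ, μ (dyadicCell l ⁻¹' {(n, k)}) :=
          ENNReal.tsum_le_tsum fun k => tsub_le_self
      _ ≤ μ (⋃ k : Fin d → ℤ, dyadicCell l ⁻¹' {(n, k)}) := by
          refine tsum_meas_le_meas_iUnion_of_disjoint _
            (fun k => measurable_dyadicCell l (measurableSet_singleton _)) fun i j hij =>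
            Disjoint.preimage _ (by simpa using hij)
      _ ≤ μ (shell ⁻¹' {n}) := by
          refine measure_mono (Set.iUnion_subset fun k x hx => ?_)
          exact congrArg Prod.fst (show dyadicCell l x = (n, k) from hx)
      _ ≤ ENNReal.ofReal m := hm

/-- Either `x` and `y` lie in a common cell of level `L`, or they are separated at a first level
`l ≤ L`, and then they share a cell of level `l - 1`. -/
theorem norm_sub_rpow_le_sum {d : ℕ} {p : ℝ} (hp : 0 < p) (x y : Fin d → ℝ) (L : ℕ) :
    ‖x - y‖ ^ p ≤ 2 ^ p * ∑ l ∈ Finset.range (L + 1), 2 ^ (-p * l) *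
        (if dyadicCell l x ≠ dyadicCell l y then 2 ^ (p * shell x) + 2 ^ (p * shell y) else 0) +
      2 ^ (-p * L) * 2 ^ (p * shell x) := by
  have hgood : ∀ l : ℕ, dyadicCell l x = dyadicCell l y →
      ‖x - y‖ ^ p ≤ 2 ^ (-p * l) * 2 ^ (p * shell x) := by
    intro l h
    refine (Real.rpow_le_rpow (norm_nonneg _) (norm_sub_le_of_dyadicCell_eq h) hp.le).trans_eq ?_
    rw [← Real.rpow_natCast, ← Real.rpow_natCast, ← Real.rpow_sub (by norm_num),
      ← Real.rpow_mul (by norm_num), ← Real.rpow_add (by norm_num)]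
    ring_nf
  have hnonneg : ∀ l : ℕ, (0 : ℝ) ≤ 2 ^ (-p * l) *
      (if dyadicCell l x ≠ dyadicCell l y then 2 ^ (p * shell x) + 2 ^ (p * shell y) else 0) := by
    intro l
    split_ifs <;> positivity
  by_cases hL : dyadicCell L x = dyadicCell L y
  · refine (hgood L hL).trans (le_add_of_nonneg_left ?_)
    exact mul_nonneg (by positivity) (Finset.sum_nonneg fun l _ => hnonneg l)
  induction L with
  | zero =>
    have h1 : ‖x - y‖ ≤ 2 * max (2 ^ shell x) (2 ^ shell y) := by
      refine (norm_sub_le _ _).trans ?_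
      linarith [norm_le_two_pow_shell x, norm_le_two_pow_shell y,
        le_max_left ((2 : ℝ) ^ shell x) (2 ^ shell y),
        le_max_right ((2 : ℝ) ^ shell x) (2 ^ shell y)]
    have h2 : (max (2 ^ shell x) (2 ^ shell y) : ℝ) ^ p ≤ 2 ^ (p * shell x) + 2 ^ (p * shell y) := by
      have e : ∀ n : ℕ, (2 : ℝ) ^ (p * n) = (2 ^ n) ^ p := fun n => by
        rw [mul_comm, Real.rpow_mul (by norm_num), Real.rpow_natCast]
      rw [e, e]
      rcases le_total ((2 : ℝ) ^ shell x) (2 ^ shell y) with h | h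
      · rw [max_eq_right h]; exact le_add_of_nonneg_left (by positivity)
      · rw [max_eq_left h]; exact le_add_of_nonneg_right (by positivity)
    have h3 := Real.rpow_le_rpow (norm_nonneg _) h1 hp.le
    rw [Real.mul_rpow (by norm_num) (by positivity)] at h3
    have h4 : (0 : ℝ) ≤ 2 ^ (-p * (0 : ℕ)) * 2 ^ (p * shell x) := by positivity
    refine le_add_of_le_of_nonneg (h3.trans ?_) h4
    rw [zero_add, Finset.sum_range_one, if_pos hL]
    simp only [Nat.cast_zero, mul_zero, Real.rpow_zero, one_mul]
    gcongr
  | succ L ih =>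
    have hprev : ‖x - y‖ ^ p ≤ 2 ^ p * ∑ l ∈ Finset.range (L + 1), 2 ^ (-p * l) *
        (if dyadicCell l x ≠ dyadicCell l y then 2 ^ (p * shell x) + 2 ^ (p * shell y) else 0) +
      2 ^ (-p * L) * 2 ^ (p * shell x) := by
      by_cases hL' : dyadicCell L x = dyadicCell L y
      · refine (hgood L hL').trans (le_add_of_nonneg_left ?_)
        exact mul_nonneg (by positivity) (Finset.sum_nonneg fun l _ => hnonneg l)
      · exact ih hL'
    refine hprev.trans ?_
    rw [Finset.sum_range_succ _ (L + 1), if_pos hL, mul_add, add_assoc]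
    gcongr
    have e : (2 : ℝ) ^ p * (2 ^ (-p * (L + 1 : ℕ)) * (2 ^ (p * shell x) + 2 ^ (p * shell y))) =
        2 ^ (-p * L) * (2 ^ (p * shell x) + 2 ^ (p * shell y)) := by
      rw [← mul_assoc, ← Real.rpow_add (by norm_num)]
      congr 2
      push_cast
      ring
    rw [e, mul_add]
    have h5 : (0 : ℝ) ≤ 2 ^ (-p * L) * 2 ^ (p * shell y) := by positivity
    have h6 : (0 : ℝ) ≤ 2 ^ (-p * (L + 1 : ℕ)) * 2 ^ (p * shell x) := by positivity
    linarith

/-! ### The Wasserstein bound -/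

/-- Markov's inequality for the mass of a dyadic shell. -/
theorem measure_shell_le {d : ℕ} (N : Seminorm ℝ (Fin d → ℝ)) {c q : ℝ} (hc : 0 < c)
    (hNc : ∀ x, ‖x‖ ≤ c * N x) (hq : 0 < q) (μ : Measure (Fin d → ℝ)) [IsProbabilityMeasure μ]
    {M : ℝ} (hM : 1 ≤ M) (hμ : absMoment N q μ ≤ ENNReal.ofReal (2 * M)) (n : ℕ) :
    μ (shell ⁻¹' {n}) ≤ ENNReal.ofReal ((2 * (2 * c) ^ q + 1) * M * 2 ^ (-q * n)) := by
  have hcq : 0 < (2 * c) ^ q := by positivity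
  rcases n with _ | n
  · refine prob_le_one.trans (ENNReal.one_le_ofReal.2 ?_)
    simp only [Nat.cast_zero, mul_zero, Real.rpow_zero, mul_one]
    nlinarith
  · have hpos : (0 : ℝ) < (2 ^ n / c) ^ q := by positivity
    have hsub : (shell ⁻¹' {n + 1} : Set (Fin d → ℝ)) ⊆
        {x | ENNReal.ofReal ((2 ^ n / c) ^ q) ≤ ENNReal.ofReal (N x) ^ q} := by
      intro x hx
      have h1 : n < shell x := by
        rw [show shell x = n + 1 from hx]; exact Nat.lt_succ_self n
      have h2 : 2 ^ n / c ≤ N x := by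
        rw [div_le_iff₀ hc, mul_comm]
        exact (two_pow_le_norm_of_lt_shell h1).trans (hNc x)
      change ENNReal.ofReal ((2 ^ n / c) ^ q) ≤ ENNReal.ofReal (N x) ^ q
      rw [ENNReal.ofReal_rpow_of_nonneg (apply_nonneg N x) hq.le]
      exact ENNReal.ofReal_le_ofReal (Real.rpow_le_rpow (by positivity) h2 hq.le)
    have hmeas : Measurable fun x => ENNReal.ofReal (N x) ^ q :=
      (ENNReal.measurable_ofReal.comp N.continuous_of_pi.measurable).pow_const q
    have hmarkov := mul_meas_ge_le_lintegral (μ := μ) hmeas (ENNReal.ofReal ((2 ^ n / c) ^ q))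
    have h3 : μ (shell ⁻¹' {n + 1}) ≤
        ENNReal.ofReal (2 * M) / ENNReal.ofReal ((2 ^ n / c) ^ q) := by
      rw [ENNReal.le_div_iff_mul_le (Or.inl (ENNReal.ofReal_pos.2 hpos).ne')
        (Or.inl ENNReal.ofReal_ne_top), mul_comm]
      exact (mul_le_mul_right (measure_mono hsub) _).trans (hmarkov.trans hμ)
    refine h3.trans ?_
    rw [← ENNReal.ofReal_div_of_pos hpos]
    refine ENNReal.ofReal_le_ofReal ?_
    have e : (2 : ℝ) ^ (-q * (n + 1 : ℕ)) = ((2 ^ n / c) ^ q)⁻¹ * ((2 * c) ^ q)⁻¹ := by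
      rw [← mul_inv, ← Real.mul_rpow (by positivity) (by positivity), neg_mul, Real.rpow_neg
        (by norm_num), mul_comm q, Real.rpow_mul (by norm_num), Real.rpow_natCast]
      congr 2
      field_simp
      ring
    rw [e]
    calc 2 * M / (2 ^ n / c) ^ q
        = (2 * (2 * c) ^ q) * M * (((2 ^ n / c) ^ q)⁻¹ * ((2 * c) ^ q)⁻¹) := by
          field_simp
      _ ≤ _ := by
          gcongr
          linarith

/-- The cost of the dyadic coupling. Level `l` and shell `n` contribute `2 ^ (-p l) * 2 ^ (p n)`, the
`p`-th power of the mesh, times the mass separated at level `l` in shell `n`; pairs that share a cell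
of the last level `L` have a cost that vanishes as `L → ∞`. -/
theorem wasserstein_rpow_le_tsum {d : ℕ} (N : Seminorm ℝ (Fin d → ℝ)) {C p q v : ℝ} (hC : 0 < C)
    (hNC : ∀ x, N x ≤ C * ‖x‖) (hp : 0 < p) (hpq : p < q) (hv : 0 ≤ v) (μ ν : Measure (Fin d → ℝ))
    [IsProbabilityMeasure μ] [IsProbabilityMeasure ν]
    (hμ : ∀ n : ℕ, μ (shell ⁻¹' {n}) ≤ ENNReal.ofReal (v * 2 ^ (-q * n)))
    (hν : ∀ n : ℕ, ν (shell ⁻¹' {n}) ≤ ENNReal.ofReal (v * 2 ^ (-q * n))) :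
    wasserstein N p μ ν ^ p ≤ ENNReal.ofReal (C ^ p * 2 ^ p * 2) *
      ∑' l : ℕ, ∑' n : ℕ, ENNReal.ofReal (2 ^ (-p * l) * (2 ^ (p * n) *
        min (2 ^ (d + 1) * (uniformDiscrepancy μ ν).toReal * 2 ^ ((d : ℝ) * l))
          (v * 2 ^ (-q * n)))) := by
  set δ := (uniformDiscrepancy μ ν).toReal with hδ
  have hδ0 : 0 ≤ δ := ENNReal.toReal_nonneg
  let g : ℕ × (Fin d → ℤ) → ℝ≥0∞ := fun i => ENNReal.ofReal (2 ^ (p * i.1))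
  let B : ℕ → ℝ≥0∞ := fun l => ∑' n : ℕ, ENNReal.ofReal (2 ^ (p * n) *
    min (2 ^ (d + 1) * δ * 2 ^ ((d : ℝ) * l)) (v * 2 ^ (-q * n)))
  -- the contribution of level `l`, for either order of the two measures
  have hlevel : ∀ (m₁ m₂ : Measure (Fin d → ℝ)) [IsProbabilityMeasure m₁]
      [IsProbabilityMeasure m₂], (uniformDiscrepancy m₁ m₂).toReal = δ →
      (∀ n : ℕ, m₁ (shell ⁻¹' {n}) ≤ ENNReal.ofReal (v * 2 ^ (-q * n))) → ∀ l : ℕ,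
      ∑' i, g i * (m₁ (dyadicCell l ⁻¹' {i}) - m₂ (dyadicCell l ⁻¹' {i})) ≤ B l := by
    intro m₁ m₂ _ _ hm hmass l
    rw [ENNReal.tsum_prod']
    refine ENNReal.tsum_le_tsum fun n => ?_
    change ∑' k : Fin d → ℤ, ENNReal.ofReal (2 ^ (p * n)) *
      (m₁ (dyadicCell l ⁻¹' {(n, k)}) - m₂ (dyadicCell l ⁻¹' {(n, k)})) ≤ _
    rw [ENNReal.tsum_mul_left, ENNReal.ofReal_mul (by positivity), ← hm]
    exact mul_le_mul_right (tsum_measure_dyadicCell_sub_le m₁ m₂ l n (hmass n)) _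
  have hsymm : uniformDiscrepancy ν μ = uniformDiscrepancy μ ν := by
    simp only [uniformDiscrepancy, abs_sub_comm]
  obtain ⟨G, -, hG⟩ := exists_tsum_geometric_le (sub_pos.2 hpq)
  -- the cost of the pairs matched at the finest level is negligible
  have hfine : ∫⁻ x, ENNReal.ofReal (2 ^ (p * shell x)) ∂μ ≤ ENNReal.ofReal (v * G) := by
    have h1 : ∫⁻ x, ENNReal.ofReal (2 ^ (p * shell x)) ∂μ =
        ∫⁻ n : ℕ, ENNReal.ofReal (2 ^ (p * n)) ∂(μ.map shell) :=
      (lintegral_map (measurable_of_countable fun n : ℕ => ENNReal.ofReal (2 ^ (p * n)))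
        measurable_shell).symm
    rw [h1, lintegral_countable']
    calc _ ≤ ∑' n : ℕ, ENNReal.ofReal v * ENNReal.ofReal (2 ^ (-(q - p) * n)) := by
          refine ENNReal.tsum_le_tsum fun n => ?_
          rw [Measure.map_apply measurable_shell (measurableSet_singleton n)]
          refine (mul_le_mul_right (hμ n) _).trans (le_of_eq ?_)
          rw [← ENNReal.ofReal_mul (by positivity), ← ENNReal.ofReal_mul hv, mul_left_comm,
            ← Real.rpow_add (by norm_num)]
          ring_nf
      _ ≤ _ := by
          rw [ENNReal.tsum_mul_left, ENNReal.ofReal_mul hv]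
          exact mul_le_mul_right hG _
  have hL : ∀ L : ℕ, wasserstein N p μ ν ^ p ≤
      ENNReal.ofReal (C ^ p) * (ENNReal.ofReal (2 ^ p) *
        ∑' l : ℕ, ENNReal.ofReal (2 ^ (-p * l)) * (B l + B l) +
        ENNReal.ofReal (2 ^ (-p * L)) * ENNReal.ofReal (v * G)) := by
    intro L
    obtain ⟨π, h1, h2, h3⟩ := exists_coupling_of_refining μ ν
      (f := fun l => dyadicCell (d := d) l) measurable_dyadicCell dyadicCell_eq_of_succ L
    have hπ : IsProbabilityMeasure π := ⟨by rw [← Measure.fst_univ, h1, measure_univ]⟩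
    have hW : wasserstein N p μ ν ^ p ≤ ∫⁻ z, ENNReal.ofReal (N (z.1 - z.2)) ^ p ∂π := by
      have h4 : wasserstein N p μ ν ≤
          (∫⁻ z, ENNReal.ofReal (N (z.1 - z.2)) ^ p ∂π) ^ (1 / p) :=
        iInf₂_le π (show π ∈ couplings μ ν from ⟨h1, h2⟩)
      refine (ENNReal.rpow_le_rpow h4 hp.le).trans_eq ?_
      rw [← ENNReal.rpow_mul, one_div_mul_cancel hp.ne', ENNReal.rpow_one]
    let F₁ : ℕ → (Fin d → ℝ) × (Fin d → ℝ) → ℝ≥0∞ := fun l z =>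
      if dyadicCell l z.1 ≠ dyadicCell l z.2 then g (dyadicCell l z.1) else 0
    let F₂ : ℕ → (Fin d → ℝ) × (Fin d → ℝ) → ℝ≥0∞ := fun l z =>
      if dyadicCell l z.1 ≠ dyadicCell l z.2 then g (dyadicCell l z.2) else 0
    have hpair : ∀ l, Measurable fun z : (Fin d → ℝ) × (Fin d → ℝ) =>
        (dyadicCell l z.1, dyadicCell l z.2) := fun l =>
      ((measurable_dyadicCell l).comp measurable_fst).prodMk
        ((measurable_dyadicCell l).comp measurable_snd)
    have hF₁ : ∀ l, Measurable (F₁ l) := fun l =>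
      (measurable_of_countable fun ij : (ℕ × (Fin d → ℤ)) × (ℕ × (Fin d → ℤ)) =>
        if ij.1 ≠ ij.2 then g ij.1 else 0).comp (hpair l)
    have hF₂ : ∀ l, Measurable (F₂ l) := fun l =>
      (measurable_of_countable fun ij : (ℕ × (Fin d → ℤ)) × (ℕ × (Fin d → ℤ)) =>
        if ij.1 ≠ ij.2 then g ij.2 else 0).comp (hpair l)
    have hpt : ∀ z : (Fin d → ℝ) × (Fin d → ℝ), ENNReal.ofReal (N (z.1 - z.2)) ^ p ≤
        ENNReal.ofReal (C ^ p) * (ENNReal.ofReal (2 ^ p) *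
          ∑ l ∈ Finset.range (L + 1), ENNReal.ofReal (2 ^ (-p * l)) * (F₁ l z + F₂ l z) +
          ENNReal.ofReal (2 ^ (-p * L)) * ENNReal.ofReal (2 ^ (p * shell z.1))) := by
      intro z
      have h5 : N (z.1 - z.2) ^ p ≤ C ^ p * ‖z.1 - z.2‖ ^ p := by
        rw [← Real.mul_rpow hC.le (norm_nonneg _)]
        exact Real.rpow_le_rpow (apply_nonneg N _) (hNC _) hp.le
      rw [ENNReal.ofReal_rpow_of_nonneg (apply_nonneg N _) hp.le]
      refine (ENNReal.ofReal_le_ofReal (h5.trans (mul_le_mul_of_nonneg_left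
        (norm_sub_rpow_le_sum hp z.1 z.2 L) (by positivity)))).trans_eq ?_
      have hite : ∀ l : ℕ, (0 : ℝ) ≤ (if dyadicCell l z.1 ≠ dyadicCell l z.2 then
          2 ^ (p * shell z.1) + 2 ^ (p * shell z.2) else 0) := fun l => by
        split_ifs <;> positivity
      have hterm : ∀ l : ℕ, (0 : ℝ) ≤ 2 ^ (-p * l) * (if dyadicCell l z.1 ≠ dyadicCell l z.2 then
          2 ^ (p * shell z.1) + 2 ^ (p * shell z.2) else 0) := fun l =>
        mul_nonneg (by positivity) (hite l)
      rw [ENNReal.ofReal_mul (by positivity), ENNReal.ofReal_add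
        (mul_nonneg (by positivity) (Finset.sum_nonneg fun l _ => hterm l)) (by positivity),
        ENNReal.ofReal_mul (by positivity), ENNReal.ofReal_mul (by positivity),
        ENNReal.ofReal_sum_of_nonneg fun l _ => hterm l]
      congr 4
      refine funext fun l => ?_
      rw [ENNReal.ofReal_mul (by positivity)]
      congr 1
      simp only [F₁, F₂, g]
      split_ifs
      · rw [ENNReal.ofReal_add (by positivity) (by positivity)]
        rfl
      · simp
    refine hW.trans ((lintegral_mono hpt).trans ?_)
    have hsummand : ∀ l : ℕ, Measurable fun z =>
        ENNReal.ofReal (2 ^ (-p * l)) * (F₁ l z + F₂ l z) :=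
      fun l => ((hF₁ l).add (hF₂ l)).const_mul _
    have hsum : Measurable fun z => ∑ l ∈ Finset.range (L + 1),
        ENNReal.ofReal (2 ^ (-p * l)) * (F₁ l z + F₂ l z) :=
      Finset.measurable_fun_sum _ fun l _ => hsummand l
    have hshell : Measurable fun x : Fin d → ℝ => ENNReal.ofReal (2 ^ (p * shell x)) :=
      (measurable_of_countable fun n : ℕ => ENNReal.ofReal (2 ^ (p * n))).comp measurable_shell
    rw [lintegral_const_mul' _ _ ENNReal.ofReal_ne_top, lintegral_add_left (hsum.const_mul _),
      lintegral_const_mul' _ _ ENNReal.ofReal_ne_top, lintegral_const_mul' _ _ ENNReal.ofReal_ne_top,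
      lintegral_finsetSum _ fun l _ => hsummand l]
    gcongr
    · refine le_trans (Finset.sum_le_sum fun l hl => ?_) (ENNReal.sum_le_tsum (Finset.range (L + 1)))
      have hlL : l ≤ L := Nat.lt_succ_iff.1 (Finset.mem_range.1 hl)
      rw [lintegral_const_mul' _ _ ENNReal.ofReal_ne_top, lintegral_add_left (hF₁ l)]
      gcongr
      · exact (lintegral_ite_ne_le h1 (measurable_dyadicCell l) (h3 l hlL) g).trans
          (hlevel μ ν rfl hμ l)
      · exact (lintegral_ite_ne_le' h2 (measurable_dyadicCell l) (h3 l hlL) g).trans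
          (hlevel ν μ (by rw [hsymm]) hν l)
    · refine le_trans (le_of_eq ?_) hfine
      rw [← h1, Measure.fst, lintegral_map hshell measurable_fst]
  have htend : Tendsto (fun L : ℕ => ENNReal.ofReal (C ^ p) * (ENNReal.ofReal (2 ^ p) *
        ∑' l : ℕ, ENNReal.ofReal (2 ^ (-p * l)) * (B l + B l) +
        ENNReal.ofReal (2 ^ (-p * L)) * ENNReal.ofReal (v * G))) atTop
      (𝓝 (ENNReal.ofReal (C ^ p) * (ENNReal.ofReal (2 ^ p) *
        ∑' l : ℕ, ENNReal.ofReal (2 ^ (-p * l)) * (B l + B l) +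
        ENNReal.ofReal 0 * ENNReal.ofReal (v * G)))) := by
    have h0 : Tendsto (fun L : ℕ => (2 : ℝ) ^ (-p * L)) atTop (𝓝 0) := by
      have := tendsto_pow_atTop_nhds_zero_of_lt_one (r := (2 : ℝ) ^ (-p)) (by positivity)
        (Real.rpow_lt_one_of_one_lt_of_neg (by norm_num) (by linarith))
      refine this.congr fun L => ?_
      rw [Real.rpow_mul (by norm_num), Real.rpow_natCast]
    refine ENNReal.Tendsto.const_mul (tendsto_const_nhds.add
      (ENNReal.Tendsto.mul_const (ENNReal.tendsto_ofReal h0) (Or.inr ENNReal.ofReal_ne_top)))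
      (Or.inr ENNReal.ofReal_ne_top)
  refine (ge_of_tendsto' htend hL).trans_eq ?_
  rw [ENNReal.ofReal_zero, zero_mul, add_zero, ← mul_assoc, ← ENNReal.ofReal_mul (by positivity),
    ENNReal.ofReal_mul (by positivity : 0 ≤ C ^ p * 2 ^ p), mul_assoc]
  congr 1
  rw [← ENNReal.tsum_mul_left]
  refine tsum_congr fun l => ?_
  have e : ∑' n : ℕ, ENNReal.ofReal (2 ^ (-p * l) * (2 ^ (p * n) *
      min (2 ^ (d + 1) * δ * 2 ^ ((d : ℝ) * l)) (v * 2 ^ (-q * n)))) =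
      ENNReal.ofReal (2 ^ (-p * l)) * B l := by
    simp only [B]
    rw [← ENNReal.tsum_mul_left]
    refine tsum_congr fun n => ?_
    rw [ENNReal.ofReal_mul (by positivity)]
  rw [e, ← two_mul, ENNReal.ofReal_ofNat]
  ring

/-- A bound of the double series by `u ^ θ * v ^ (1 - θ)` gives the Wasserstein bound with
exponent `θ`. -/
theorem exists_wasserstein_rpow_le {d : ℕ} (N : Seminorm ℝ (Fin d → ℝ))
    (hN : ∀ x, N x = 0 → x = 0) {p q θ A : ℝ} (hp : 0 < p) (hpq : p < q) (hθ : 0 ≤ θ)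
    (hA : 0 < A)
    (h : ∀ u v : ℝ, 0 ≤ u → 0 ≤ v →
      ∑' l : ℕ, ∑' n : ℕ, ENNReal.ofReal (2 ^ (-p * l) * (2 ^ (p * n) *
        min (u * 2 ^ ((d : ℝ) * l)) (v * 2 ^ (-q * n)))) ≤
        ENNReal.ofReal (A * (u ^ θ * v ^ (1 - θ)))) :
    ∃ κ : ℝ, 0 < κ ∧ ∀ (μ ν : Measure (Fin d → ℝ)) [IsProbabilityMeasure μ]
      [IsProbabilityMeasure ν], absMoment N q μ < ∞ → absMoment N q ν < ∞ →
      wasserstein N p μ ν ^ p ≤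
        ENNReal.ofReal κ * max (absMoment N q ((2⁻¹ : ℝ≥0∞) • (μ + ν))) 1 *
          uniformDiscrepancy μ ν ^ θ := by
  obtain ⟨C, hC, hNC⟩ := N.exists_le_mul_norm
  obtain ⟨c, hc, hNc⟩ := N.exists_norm_le_mul hN
  set K := 2 * (2 * c) ^ q + 1 with hK
  have hKpos : 0 < K := by positivity
  refine ⟨C ^ p * 2 ^ p * 2 * (A * ((2 ^ (d + 1)) ^ θ * K ^ (1 - θ))), by positivity,
    fun μ ν _ _ hμ hν => ?_⟩
  have havg : absMoment N q ((2⁻¹ : ℝ≥0∞) • (μ + ν)) =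
      2⁻¹ * (absMoment N q μ + absMoment N q ν) := by
    simp only [absMoment, lintegral_smul_measure, lintegral_add_measure, smul_eq_mul]
  have htop : max (absMoment N q ((2⁻¹ : ℝ≥0∞) • (μ + ν))) 1 ≠ ∞ := by
    rw [havg]
    exact (max_lt (ENNReal.mul_lt_top (by simp) (ENNReal.add_lt_top.2 ⟨hμ, hν⟩))
      ENNReal.one_lt_top).ne
  set M := (max (absMoment N q ((2⁻¹ : ℝ≥0∞) • (μ + ν))) 1).toReal with hMdef
  have hMof : max (absMoment N q ((2⁻¹ : ℝ≥0∞) • (μ + ν))) 1 = ENNReal.ofReal M :=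
    (ENNReal.ofReal_toReal htop).symm
  have hM : 1 ≤ M := by
    rw [← ENNReal.one_le_ofReal, ← hMof]
    exact le_max_right _ _
  have hsum : absMoment N q μ + absMoment N q ν ≤ ENNReal.ofReal (2 * M) := by
    rw [ENNReal.ofReal_mul (by norm_num), ENNReal.ofReal_ofNat, ← hMof, havg]
    calc absMoment N q μ + absMoment N q ν
        = 2 * (2⁻¹ * (absMoment N q μ + absMoment N q ν)) := by
          rw [← mul_assoc, ENNReal.mul_inv_cancel (by norm_num) (by norm_num), one_mul]
      _ ≤ _ := mul_le_mul_right (le_max_left _ _) _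
  have hq : 0 < q := hp.trans hpq
  have hmain := wasserstein_rpow_le_tsum N hC hNC hp hpq (v := K * M) (by positivity) μ ν
    (measure_shell_le N hc hNc hq μ hM (le_self_add.trans hsum))
    (measure_shell_le N hc hNc hq ν hM (le_add_self.trans hsum))
  set δ := (uniformDiscrepancy μ ν).toReal with hδ
  have hδ0 : 0 ≤ δ := ENNReal.toReal_nonneg
  have hδof : uniformDiscrepancy μ ν = ENNReal.ofReal δ :=
    (ENNReal.ofReal_toReal ((uniformDiscrepancy_le_one μ ν).trans_lt ENNReal.one_lt_top).ne).symm
  refine hmain.trans ((mul_le_mul_right (h _ _ (by positivity) (by positivity)) _).trans ?_)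
  rw [hMof, hδof, ENNReal.ofReal_rpow_of_nonneg hδ0 hθ, ← ENNReal.ofReal_mul (by positivity),
    ← ENNReal.ofReal_mul (by positivity), ← ENNReal.ofReal_mul (by positivity)]
  refine ENNReal.ofReal_le_ofReal ?_
  have hMθ : M ^ (1 - θ) ≤ M := by
    simpa using Real.rpow_le_rpow_of_exponent_le hM (by linarith : 1 - θ ≤ 1)
  rw [Real.mul_rpow (by positivity) hδ0, Real.mul_rpow hKpos.le (by positivity)]
  calc _ = C ^ p * 2 ^ p * 2 * (A * ((2 ^ (d + 1)) ^ θ * K ^ (1 - θ))) * M ^ (1 - θ) * δ ^ θ := by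
        ring
    _ ≤ _ := by gcongr

theorem mainTheorem2 (d : ℕ) (hd : 1 ≤ d)
    (N : Seminorm ℝ (Fin d → ℝ)) (hN : ∀ x, N x = 0 → x = 0)
    (p q : ℝ) (hp : 1 ≤ p) (hpq : p < q) :
    ∃ κ : ℝ, 0 < κ ∧
      ∀ (μ ν : Measure (Fin d → ℝ)) [IsProbabilityMeasure μ] [IsProbabilityMeasure ν],
        absMoment N q μ < ∞ → absMoment N q ν < ∞ →
        (p < d * q / (q + d) →
          wasserstein N p μ ν ^ p ≤
              ENNReal.ofReal κ * max (absMoment N q ((2⁻¹ : ℝ≥0∞) • (μ + ν))) 1 *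
                uniformDiscrepancy μ ν ^ (p / d) ∧
          wasserstein N p μ ν ^ p ≤
              ENNReal.ofReal κ * max (absMoment N q ((2⁻¹ : ℝ≥0∞) • (μ + ν))) 1 *
                (2 ^ d * ksDistance μ ν) ^ (p / d)) ∧
        (d * q / (q + d) < p → p ≠ d →
          wasserstein N p μ ν ^ p ≤
              ENNReal.ofReal κ * max (absMoment N q ((2⁻¹ : ℝ≥0∞) • (μ + ν))) 1 *
                uniformDiscrepancy μ ν ^ (1 - p / q) ∧
          wasserstein N p μ ν ^ p ≤
              ENNReal.ofReal κ * max (absMoment N q ((2⁻¹ : ℝ≥0∞) • (μ + ν))) 1 *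
                (2 ^ d * ksDistance μ ν) ^ (1 - p / q)) := by
  have hp0 : 0 < p := one_pos.trans_le hp
  have hq0 : 0 < q := hp0.trans hpq
  have hd0 : (0 : ℝ) < d := by exact_mod_cast hd
  have hpq1 : p / q < 1 := (div_lt_one hq0).2 hpq
  rcases lt_trichotomy p (d * q / (q + d)) with hlt | heq | hgt
  · obtain ⟨A, hA, h⟩ := exists_double_tsum_le_of_lt hp0 hq0 hd0 hlt
    have hθ : 0 ≤ p / d := by positivity
    obtain ⟨κ, hκ, H⟩ := exists_wasserstein_rpow_le N hN hp0 hpq hθ hA h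
    refine ⟨κ, hκ, fun μ ν _ _ hμ hν => ⟨fun _ => ⟨H μ ν hμ hν, (H μ ν hμ hν).trans ?_⟩,
      fun hgt => absurd hgt hlt.not_gt⟩⟩
    exact mul_le_mul_right
      (ENNReal.rpow_le_rpow (uniformDiscrepancy_le_two_pow_mul_ksDistance μ ν) hθ) _
  -- at the critical exponent neither bound is claimed
  · exact ⟨1, one_pos, fun μ ν _ _ _ _ =>
      ⟨fun h => absurd h heq.not_lt, fun h => absurd h heq.not_gt⟩⟩
  · obtain ⟨A, hA, h⟩ := exists_double_tsum_le_of_gt hp0 hpq hd0 hgt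
    have hθ : 0 ≤ 1 - p / q := by linarith
    obtain ⟨κ, hκ, H⟩ := exists_wasserstein_rpow_le N hN hp0 hpq hθ hA
      (by simpa only [sub_sub_cancel] using h)
    refine ⟨κ, hκ, fun μ ν _ _ hμ hν => ⟨fun hlt => absurd hlt hgt.not_gt,
      fun _ _ => ⟨H μ ν hμ hν, (H μ ν hμ hν).trans ?_⟩⟩⟩
    exact mul_le_mul_right
      (ENNReal.rpow_le_rpow (uniformDiscrepancy_le_two_pow_mul_ksDistance μ ν) hθ) _
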